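/- Let $K$ be a field and let $l,m,n$ be positive integers such that $2\le m\le n$, $l\mid n$ and $l\le\min\{m-1,\tfrac n2\}$. Let $R=K[x_1,\dots,x_n]$ with the standard grading, where indices of variables are read modulo $n$. Put $k=\frac nl$ and let $$I_{m,l}(C_n)=(u_1,\dots,u_k)\subseteq R,\qquad u_i=\prod_{j=1}^{m}x_{(i-1)l+j}\quad(1\le i\le k),$$ be the path ideal of the $n$-cycle $C_n$. Write $m=tl+s$ with $0\le s<l$ and assume $t\ge 2$. Write $k=p(t+1)+d$ with $p\ge 0$ and $0\le d\le t$. For $i\ge 0$ let $\beta_{i,n}(R/I_{m,l}(C_n))$ be the graded Betti number in homological degree $i$ and internal degree $n$, that is, the multiplicity of $R(-n)$ in the $i$-th free module of a minimal graded free resolution of $R/I_{m,l}(C_n)$ (such a resolution exists, and this number does not depend on its choice). Then $$\beta_{i,n}\bigl(R/I_{m,l}(C_n)\bigr)=\begin{cases}t,&\text{if } d=0 \text{ and } i=2p;\\ 1,&\text{if } d\neq 0 \text{ and } i=2p+1;\\ 0,&\text{otherwise.}\end{cases}$$ -/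

import Mathlib

open MvPolynomial

/-- The degree-`j` component of the graded free module `⨁ₐ R(-deg a)` over the standard graded
polynomial ring `R = K[x_s : s ∈ σ]`, whose elements are written as vectors `v : ι → R`. The basis
vector `e_a` has degree `deg a`, so a term `c • x^e • e_a` has degree `|e| + deg a`; the component
consists of the vectors all of whose terms have degree `j`. -/
def gradedFreePiece {σ K ι : Type*} [Field K] (deg : ι → ℕ) (j : ℕ) :
    Set (ι → MvPolynomial σ K) :=
  {v | ∀ a, ∀ e ∈ (v a).support, e.degree + deg a = j}

/-- A minimal graded free resolution
`⋯ → F₂ → F₁ → F₀ → R ⧸ I → 0` of `R ⧸ I`, where `R = K[x_s : s ∈ σ]` is standard graded,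
`F_i = ⨁ₐ R(-deg i a)` is graded free of finite rank, all maps are graded of degree `0`, the
sequence is exact, and the image of every differential lies in `𝔪 F_i`, where `𝔪` is the ideal
generated by the variables. -/
structure MinimalGradedFreeResolution {σ K : Type*} [Field K] (I : Ideal (MvPolynomial σ K)) where
  /-- the rank of `F_i` -/
  rank : ℕ → ℕ
  /-- the degrees of the basis elements of `F_i` -/
  deg : ∀ i, Fin (rank i) → ℕ
  /-- the differential `F_{i+1} → F_i` -/
  d : ∀ i, (Fin (rank (i + 1)) → MvPolynomial σ K) →ₗ[MvPolynomial σ K]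
    (Fin (rank i) → MvPolynomial σ K)
  /-- the augmentation `F₀ → R ⧸ I` -/
  aug : (Fin (rank 0) → MvPolynomial σ K) →ₗ[MvPolynomial σ K] (MvPolynomial σ K ⧸ I)
  d_graded : ∀ i j, ∀ v ∈ gradedFreePiece (deg (i + 1)) j, d i v ∈ gradedFreePiece (deg i) j
  /-- The degree-`j` component of `R ⧸ I` is the image of that of `R`. -/
  aug_graded : ∀ j, ∀ v ∈ gradedFreePiece (deg 0) j,
    ∃ f : MvPolynomial σ K, f.IsHomogeneous j ∧ aug v = Ideal.Quotient.mk I f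
  aug_surjective : Function.Surjective aug
  exact_zero : Function.Exact (d 0) aug
  exact_succ : ∀ i, Function.Exact (d (i + 1)) (d i)
  minimal : ∀ i v a, d i v a ∈ Ideal.span (Set.range (X : σ → MvPolynomial σ K))

/-- The multiplicity of `R(-j)` in the `i`-th module `F_i` of a minimal graded free resolution of
`R ⧸ I`, that is, the graded Betti number `β_{i,j}(R ⧸ I)` as read off from this resolution. -/
def MinimalGradedFreeResolution.betti {σ K : Type*} [Field K] {I : Ideal (MvPolynomial σ K)}
    (F : MinimalGradedFreeResolution I) (i j : ℕ) : ℕ :=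
  (Finset.univ.filter fun a : Fin (F.rank i) => F.deg i a = j).card

/-- The path ideal `I_{m,l}(C_n)` of the `n`-cycle in `K[x_1, …, x_n]`, generated by the monomials
`∏_{j=1}^m x_{(i-1)l+j}` for `1 ≤ i ≤ n / gcd(l, n)`, where the indices of the variables are taken
modulo `n`. -/
noncomputable def cyclePathIdeal (K : Type*) [Field K] (m l n : ℕ) : Ideal (MvPolynomial (ZMod n) K) :=
  Ideal.span {u | ∃ i ∈ Finset.Icc 1 (n / Nat.gcd l n),
    u = ∏ j ∈ Finset.Icc 1 m, X (((i - 1) * l + j : ℕ) : ZMod n)}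

/-! The multiplicity of `R(-n)` in degree `i` of a minimal resolution is the dimension of the `i`-th
homology of the degree-`n` part of any graded free resolution reduced modulo the variables
(`exists_reduced_maps`, `betti_succ_add`). The Taylor resolution on the generators `u_1, …, u_k` is
used; it is exact even if generators coincide, which happens for `m = n`. Its degree-`n` part has as
basis the sets `S` of generators whose lcm is the product of all variables.

Cut the cycle into `k` blocks of length `l`. A path contains `t` consecutive blocks entirely and
only `s < l` further vertices, so it misses the last vertex of every other block. Hence the lcm of
`S` is full exactly when the cyclic intervals of length `t` starting at the elements of `S` cover a
`k`-cycle (`CyclePath.cov_iff`).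

These covers carry an acyclic matching. Let `e` be the last element of `S`. The greedy pattern that
starts from `e - k` and `0` and repeats with period `t + 1` consists of the nodes. If `S` contains a
non-node, toggle the last node before the first non-node of `S`: this changes neither `e` nor the
first non-node, and the result is still a cover (`Cov.erase`). The unmatched covers consist of all
nodes up to `e`, so they are determined by `e` with `k - t ≤ e < k` and `t + 1 ∣ e` or `t + 1 ∣ k`.
There are `t` of them, of size `2p`, if `d = 0`, and one, of size `2p + 1`, otherwise
(`card_critical_eq`).

Acyclicity makes the matched part of each differential triangular, which bounds its rank from below
(`card_upper_le_finrank`). As the unmatched covers all have the same size, `d² = 0` forces these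
bounds to be equalities (`rank_eq_of_concentrated`), and the homology has the number of unmatched
covers as its dimension. -/

set_option linter.unusedSectionVars false

/-! ### Graded pieces of free modules over the polynomial ring -/

namespace GradedFree

section Pieces

variable {σ K ι κ μ : Type*} [Field K]

theorem mem_piece {deg : ι → ℕ} {j : ℕ} {v : ι → MvPolynomial σ K} :
    v ∈ gradedFreePiece deg j ↔ ∀ a e, coeff e (v a) ≠ 0 → e.degree + deg a = j := by
  simp [gradedFreePiece, mem_support_iff]

/-- The component of degree `j` as a subspace. -/
def piece (deg : ι → ℕ) (j : ℕ) : Submodule K (ι → MvPolynomial σ K) where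
  carrier := gradedFreePiece deg j
  add_mem' := by
    intro v w hv hw
    rw [mem_piece] at *
    intro a e h
    by_cases h1 : coeff e (v a) = 0
    · exact hw a e (fun h2 => h (by simp [h1, h2]))
    · exact hv a e h1
  zero_mem' := by rw [mem_piece]; simp
  smul_mem' := by
    intro c v hv
    rw [mem_piece] at *
    intro a e h
    exact hv a e (fun h2 => h (by simp [h2]))

theorem mem_piece' {deg : ι → ℕ} {j : ℕ} {v : ι → MvPolynomial σ K} :
    v ∈ gradedFreePiece deg j ↔ v ∈ piece deg j := Iff.rfl

theorem smul_mem_piece {deg : ι → ℕ} {i j : ℕ} {p : MvPolynomial σ K} {w : ι → MvPolynomial σ K}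
    (hp : ∀ e, coeff e p ≠ 0 → e.degree + i = j) (hw : w ∈ gradedFreePiece deg i) :
    p • w ∈ gradedFreePiece deg j := by
  classical
  rw [mem_piece] at *
  intro a e h
  rw [Pi.smul_apply, smul_eq_mul, coeff_mul] at h
  obtain ⟨⟨x, y⟩, hxy, hne⟩ := Finset.exists_ne_zero_of_sum_ne_zero h
  replace hxy : x + y = e := Finset.HasAntidiagonal.mem_antidiagonal.1 hxy
  have h1 := hp x (left_ne_zero_of_mul hne)
  have h2 := hw a y (right_ne_zero_of_mul hne)
  rw [← hxy, map_add]
  omega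

/-- The projection to the component of degree `j`. -/
noncomputable def comp (deg : ι → ℕ) (j : ℕ) :
    (ι → MvPolynomial σ K) →ₗ[K] (ι → MvPolynomial σ K) :=
  LinearMap.pi fun a =>
    -- Without the guard, truncated subtraction would return the constant term when `j < deg a`.
    if deg a ≤ j then homogeneousComponent (j - deg a) ∘ₗ LinearMap.proj a else 0

theorem coeff_comp (deg : ι → ℕ) (j : ℕ) (v : ι → MvPolynomial σ K) (a : ι) (e : σ →₀ ℕ) :
    coeff e (comp deg j v a) = if e.degree + deg a = j then coeff e (v a) else 0 := by
  unfold comp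
  rw [LinearMap.pi_apply]
  by_cases h : deg a ≤ j
  · simp only [h, if_true, LinearMap.comp_apply, LinearMap.proj_apply, coeff_homogeneousComponent]
    congr 1
    apply propext
    omega
  · have : ¬ (e.degree + deg a = j) := by omega
    simp [h, this]

theorem comp_mem (deg : ι → ℕ) (j : ℕ) (v : ι → MvPolynomial σ K) :
    comp deg j v ∈ gradedFreePiece deg j := by
  rw [mem_piece]
  intro a e h
  by_contra h2
  exact h (by rw [coeff_comp, if_neg h2])

theorem comp_eq_self {deg : ι → ℕ} {j : ℕ} {v : ι → MvPolynomial σ K}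
    (hv : v ∈ gradedFreePiece deg j) : comp deg j v = v := by
  rw [mem_piece] at hv
  ext a e
  rw [coeff_comp]
  split_ifs with h
  · rfl
  · by_contra h2
    exact h (hv a e (Ne.symm h2))

theorem comp_eq_zero {deg : ι → ℕ} {i j : ℕ} (hij : i ≠ j) {v : ι → MvPolynomial σ K}
    (hv : v ∈ gradedFreePiece deg i) : comp deg j v = 0 := by
  rw [mem_piece] at hv
  ext a e
  rw [coeff_comp]
  split_ifs with h
  · by_contra h2
    exact hij ((hv a e h2).symm.trans h)
  · rfl

theorem single_mem_piece [DecidableEq ι] (deg : ι → ℕ) (a : ι) (e : σ →₀ ℕ) (c : K) :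
    Pi.single a (monomial e c) ∈ gradedFreePiece deg (e.degree + deg a) := by
  classical
  rw [mem_piece]
  intro b e' h
  by_cases hb : b = a
  · subst hb
    rw [Pi.single_eq_same, coeff_monomial] at h
    by_cases he : e = e'
    · rw [he]
    · simp [he] at h
  · simp [Pi.single_eq_of_ne hb] at h

theorem basis_mem_piece [DecidableEq ι] (deg : ι → ℕ) (a : ι) :
    Pi.single a (1 : MvPolynomial σ K) ∈ gradedFreePiece deg (deg a) := by
  simpa using single_mem_piece deg a (0 : σ →₀ ℕ) (1 : K)

theorem piece_induction [Fintype ι] (deg : ι → ℕ) {P : (ι → MvPolynomial σ K) → Prop}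
    (zero : P 0) (add : ∀ v w, P v → P w → P (v + w))
    (homogeneous : ∀ j, ∀ v ∈ gradedFreePiece deg j, P v) (v : ι → MvPolynomial σ K) : P v := by
  classical
  have hs : ∀ a p, P (Pi.single a p) := by
    intro a p
    induction p using MvPolynomial.induction_on' with
    | monomial e c => exact homogeneous _ _ (single_mem_piece deg a e c)
    | add p q hp hq => rw [Pi.single_add]; exact add _ _ hp hq
  rw [← Finset.univ_sum_single v]
  exact Finset.sum_induction _ P add zero fun a _ => hs a _

/-- Graded maps of degree zero between graded free modules. -/
def IsGraded (deg : ι → ℕ) (deg' : κ → ℕ)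
    (f : (ι → MvPolynomial σ K) →ₗ[MvPolynomial σ K] (κ → MvPolynomial σ K)) : Prop :=
  ∀ j, ∀ v ∈ gradedFreePiece deg j, f v ∈ gradedFreePiece deg' j

variable {deg : ι → ℕ} {deg' : κ → ℕ} {deg'' : μ → ℕ}
  {f : (ι → MvPolynomial σ K) →ₗ[MvPolynomial σ K] (κ → MvPolynomial σ K)}
  {g : (κ → MvPolynomial σ K) →ₗ[MvPolynomial σ K] (μ → MvPolynomial σ K)}

theorem IsGraded.comp (hg : IsGraded deg' deg'' g) (hf : IsGraded deg deg' f) :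
    IsGraded deg deg'' (g ∘ₗ f) := fun j v hv => hg j _ (hf j v hv)

theorem IsGraded.map_comp [Fintype ι] (hf : IsGraded deg deg' f) (j : ℕ)
    (v : ι → MvPolynomial σ K) : f (GradedFree.comp deg j v) = GradedFree.comp deg' j (f v) := by
  induction v using piece_induction deg with
  | zero => simp
  | add v w hv hw => simp only [map_add, hv, hw]
  | homogeneous i v hv =>
    by_cases h : i = j
    · subst h
      rw [comp_eq_self hv, comp_eq_self (hf _ _ hv)]
    · rw [comp_eq_zero h hv, comp_eq_zero h (hf _ _ hv), map_zero]

theorem eq_sum_basis [Fintype ι] [DecidableEq ι] (v : ι → MvPolynomial σ K) :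
    v = ∑ a, v a • Pi.single a (1 : MvPolynomial σ K) := by
  funext b
  simp [Finset.sum_apply, Pi.single_apply]

theorem isGraded_of_basis [Fintype ι] [DecidableEq ι]
    (h : ∀ a, f (Pi.single a 1) ∈ gradedFreePiece deg' (deg a)) : IsGraded deg deg' f := by
  intro j v hv
  rw [eq_sum_basis v, map_sum, mem_piece']
  refine Submodule.sum_mem _ fun a _ => ?_
  rw [map_smul]
  exact smul_mem_piece (fun e he => mem_piece.1 hv a e he) (h a)

theorem exists_lift [Fintype ι] {N P : Type*} [AddCommGroup N] [Module (MvPolynomial σ K) N]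
    [AddCommGroup P] [Module (MvPolynomial σ K) P]
    (f : (ι → MvPolynomial σ K) →ₗ[MvPolynomial σ K] N) (g : P →ₗ[MvPolynomial σ K] N)
    (h : ∀ v, f v ∈ LinearMap.range g) :
    ∃ u : (ι → MvPolynomial σ K) →ₗ[MvPolynomial σ K] P, g ∘ₗ u = f := by
  classical
  choose w hw using h
  refine ⟨(Pi.basisFun _ ι).constr (MvPolynomial σ K) fun a => w (Pi.single a 1), ?_⟩
  refine (Pi.basisFun _ ι).ext fun a => ?_
  rw [LinearMap.comp_apply, Module.Basis.constr_basis, hw, Pi.basisFun_apply]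

theorem exists_graded_map [Fintype ι] [DecidableEq ι] (deg : ι → ℕ) (deg' : κ → ℕ)
    (w : ι → κ → MvPolynomial σ K) (hw : ∀ a, w a ∈ gradedFreePiece deg' (deg a)) :
    ∃ u : (ι → MvPolynomial σ K) →ₗ[MvPolynomial σ K] (κ → MvPolynomial σ K),
      IsGraded deg deg' u ∧ ∀ a, u (Pi.single a 1) = w a := by
  have : ∀ a, (Pi.basisFun (MvPolynomial σ K) ι).constr (MvPolynomial σ K) w (Pi.single a 1) =
      w a := by
    intro a
    rw [← Pi.basisFun_apply, Module.Basis.constr_basis]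
  exact ⟨(Pi.basisFun _ ι).constr (MvPolynomial σ K) w,
    isGraded_of_basis fun a => by rw [this]; exact hw a, this⟩

theorem ext_basis [Fintype ι] [DecidableEq ι] {N : Type*} [AddCommGroup N]
    [Module (MvPolynomial σ K) N] {f g : (ι → MvPolynomial σ K) →ₗ[MvPolynomial σ K] N}
    (h : ∀ a, f (Pi.single a 1) = g (Pi.single a 1)) : f = g :=
  (Pi.basisFun _ ι).ext fun a => by rw [Pi.basisFun_apply]; exact h a

theorem exists_graded_lift [Fintype ι] [Fintype κ] [DecidableEq ι]
    {f : (ι → MvPolynomial σ K) →ₗ[MvPolynomial σ K] (μ → MvPolynomial σ K)}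
    (hf : IsGraded deg deg'' f) (hg : IsGraded deg' deg'' g)
    (h : ∀ v, f v ∈ LinearMap.range g) :
    ∃ u : (ι → MvPolynomial σ K) →ₗ[MvPolynomial σ K] (κ → MvPolynomial σ K),
      IsGraded deg deg' u ∧ g ∘ₗ u = f := by
  choose w hw using h
  obtain ⟨u, hu, hu2⟩ := exists_graded_map deg deg'
    (fun a => GradedFree.comp deg' (deg a) (w (Pi.single a 1))) (fun a => comp_mem _ _ _)
  refine ⟨u, hu, ext_basis fun a => ?_⟩
  rw [LinearMap.comp_apply, hu2, hg.map_comp, hw, comp_eq_self (hf _ _ (basis_mem_piece deg a))]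

end Pieces

/-! ### Reduction of maps modulo the variables in a fixed degree -/

section Reduction

variable {σ K ι κ μ : Type*} [Field K] [Fintype ι] [Fintype κ] [Fintype μ]
  [DecidableEq ι] [DecidableEq κ] [DecidableEq μ]

/-- The map induced modulo the ideal generated by the variables, in degree `n`. -/
noncomputable def red (deg : ι → ℕ) (deg' : κ → ℕ) (n : ℕ)
    (f : (ι → MvPolynomial σ K) →ₗ[MvPolynomial σ K] (κ → MvPolynomial σ K)) :
    ({a // deg a = n} → K) →ₗ[K] ({b // deg' b = n} → K) :=
  Matrix.mulVecLin (Matrix.of fun b a => constantCoeff (f (Pi.single a.1 1) b.1))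

variable {deg : ι → ℕ} {deg' : κ → ℕ} {deg'' : μ → ℕ} {n : ℕ}
  {f f' : (ι → MvPolynomial σ K) →ₗ[MvPolynomial σ K] (κ → MvPolynomial σ K)}
  {g : (κ → MvPolynomial σ K) →ₗ[MvPolynomial σ K] (μ → MvPolynomial σ K)}

theorem red_apply (v : {a // deg a = n} → K) (b : {b // deg' b = n}) :
    red deg deg' n f v b = ∑ a, constantCoeff (f (Pi.single a.1 1) b.1) * v a := rfl

theorem red_add : red deg deg' n (f + f') = red deg deg' n f + red deg deg' n f' := by
  ext v b
  simp [red_apply, add_mul, Finset.sum_add_distrib]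

theorem red_sub : red deg deg' n (f - f') = red deg deg' n f - red deg deg' n f' := by
  ext v b
  simp [red_apply, sub_mul, Finset.sum_sub_distrib]

theorem red_zero : red deg deg' n
    (0 : (ι → MvPolynomial σ K) →ₗ[MvPolynomial σ K] (κ → MvPolynomial σ K)) = 0 := by
  ext v b
  simp [red_apply]

theorem red_id : red deg deg n
    (LinearMap.id : (ι → MvPolynomial σ K) →ₗ[MvPolynomial σ K] _) = LinearMap.id := by
  unfold red
  rw [← Matrix.mulVecLin_one]
  ext b a
  by_cases h : b = a
  · simp [h]
  · simp [h, Pi.single_apply, Subtype.coe_injective.ne (Ne.symm h)]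

/-- An entry of the composite sums over all basis elements `b` in the middle, while the product of
reductions sees only those of degree `n`. The hypothesis kills the rest; it holds as soon as one of
the two maps is graded, so homotopies need not be graded. -/
theorem red_comp_aux (h : ∀ (a : ι) (c : μ) (b : κ), deg a = n → deg'' c = n → deg' b ≠ n →
    constantCoeff (f (Pi.single a 1) b) * constantCoeff (g (Pi.single b 1) c) = 0) :
    red deg deg'' n (g ∘ₗ f) = red deg' deg'' n g ∘ₗ red deg deg' n f := by
  unfold red
  rw [← Matrix.mulVecLin_mul]
  congr 1
  ext c a
  simp only [Matrix.of_apply, Matrix.mul_apply, LinearMap.comp_apply]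
  conv_lhs => rw [eq_sum_basis (f (Pi.single a.1 1))]
  simp only [map_sum, map_smul, Finset.sum_apply, Pi.smul_apply, smul_eq_mul, map_mul]
  rw [← Finset.sum_subset (Finset.subset_univ (Finset.univ.filter fun b => deg' b = n))]
  · rw [← Finset.sum_subtype_eq_sum_filter, Finset.subtype_univ]
    exact Finset.sum_congr rfl fun b _ => mul_comm _ _
  · intro b _ hb
    exact h _ _ _ a.2 c.2 (by simpa using hb)

theorem constantCoeff_eq_zero {a : ι} {b : κ} (hf : IsGraded deg deg' f)
    (hab : deg a ≠ deg' b) : constantCoeff (f (Pi.single a 1) b) = 0 := by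
  by_contra h
  have := mem_piece.1 (hf _ _ (basis_mem_piece deg a)) b 0 h
  simp at this
  exact hab this.symm

theorem red_comp_of_left (hg : IsGraded deg' deg'' g) :
    red deg deg'' n (g ∘ₗ f) = red deg' deg'' n g ∘ₗ red deg deg' n f := by
  refine red_comp_aux fun a c b ha hc hb => ?_
  rw [constantCoeff_eq_zero hg (by rw [hc]; exact hb), mul_zero]

theorem red_comp_of_right (hf : IsGraded deg deg' f) :
    red deg deg'' n (g ∘ₗ f) = red deg' deg'' n g ∘ₗ red deg deg' n f := by
  refine red_comp_aux fun a c b ha hc hb => ?_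
  rw [constantCoeff_eq_zero hf (by rw [ha]; exact hb.symm), zero_mul]

end Reduction

end GradedFree

/-! ### Graded free resolutions and the comparison theorem -/

open GradedFree

/-- A graded free resolution of `R ⧸ I` by modules of finite rank, not necessarily minimal, with
arbitrary index types for the bases. -/
structure GradedFreeResolution {σ K : Type*} [Field K] (I : Ideal (MvPolynomial σ K)) where
  /-- the index types of the bases -/
  ι : ℕ → Type
  [fin : ∀ i, Fintype (ι i)]
  [dec : ∀ i, DecidableEq (ι i)]
  /-- the degrees of the basis elements -/
  deg : ∀ i, ι i → ℕ
  /-- the differential -/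
  d : ∀ i, (ι (i + 1) → MvPolynomial σ K) →ₗ[MvPolynomial σ K] (ι i → MvPolynomial σ K)
  /-- the augmentation -/
  aug : (ι 0 → MvPolynomial σ K) →ₗ[MvPolynomial σ K] (MvPolynomial σ K ⧸ I)
  d_graded : ∀ i, IsGraded (deg (i + 1)) (deg i) (d i)
  aug_graded : ∀ j, ∀ v ∈ gradedFreePiece (deg 0) j,
    ∃ f : MvPolynomial σ K, f.IsHomogeneous j ∧ aug v = Ideal.Quotient.mk I f
  aug_surjective : Function.Surjective aug
  exact_zero : Function.Exact (d 0) aug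
  exact_succ : ∀ i, Function.Exact (d (i + 1)) (d i)

attribute [instance] GradedFreeResolution.fin GradedFreeResolution.dec

/-- A minimal graded free resolution, regarded as a graded free resolution. -/
def MinimalGradedFreeResolution.toGradedFreeResolution {σ K : Type*} [Field K]
    {I : Ideal (MvPolynomial σ K)} (F : MinimalGradedFreeResolution I) :
    GradedFreeResolution I where
  ι i := Fin (F.rank i)
  deg := F.deg
  d := F.d
  aug := F.aug
  d_graded := F.d_graded
  aug_graded := F.aug_graded
  aug_surjective := F.aug_surjective
  exact_zero := F.exact_zero
  exact_succ := F.exact_succ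

namespace GradedFreeResolution

variable {σ K : Type*} [Field K] {I : Ideal (MvPolynomial σ K)}

theorem range_d_succ (F : GradedFreeResolution I) {i : ℕ} {v} :
    v ∈ LinearMap.range (F.d (i + 1)) ↔ F.d i v = 0 := (F.exact_succ i v).symm

theorem range_d_zero (F : GradedFreeResolution I) {v} :
    v ∈ LinearMap.range (F.d 0) ↔ F.aug v = 0 := (F.exact_zero v).symm

theorem d_d (F : GradedFreeResolution I) (i : ℕ) (v) : F.d i (F.d (i + 1) v) = 0 :=
  F.range_d_succ.1 ⟨v, rfl⟩

/-- Any preimage `w` of the class of `f` can be replaced by its degree-`j` component: the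
augmentation respects components up to `I`, and `I` is homogeneous. -/
theorem exists_aug_eq (F : GradedFreeResolution I)
    (hI : ∀ f ∈ I, ∀ j, homogeneousComponent j f ∈ I) {j : ℕ} {f : MvPolynomial σ K}
    (hf : f.IsHomogeneous j) :
    ∃ w ∈ gradedFreePiece (F.deg 0) j, F.aug w = Ideal.Quotient.mk I f := by
  obtain ⟨w, hw⟩ := F.aug_surjective (Ideal.Quotient.mk I f)
  have key : ∀ w, ∃ f', F.aug w = Ideal.Quotient.mk I f' ∧
      ∀ j, F.aug (comp (F.deg 0) j w) = Ideal.Quotient.mk I (homogeneousComponent j f') := by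
    intro w
    induction w using piece_induction (F.deg 0) with
    | zero => exact ⟨0, by simp, by simp⟩
    | add v w hv hw =>
      obtain ⟨f, hf, hf'⟩ := hv
      obtain ⟨g, hg, hg'⟩ := hw
      exact ⟨f + g, by simp [hf, hg], fun j => by simp [hf', hg']⟩
    | homogeneous i v hv =>
      obtain ⟨f, hf, hf'⟩ := F.aug_graded i v hv
      refine ⟨f, hf', fun j => ?_⟩
      rw [homogeneousComponent_of_mem hf]
      split_ifs with h
      · subst h
        rw [comp_eq_self hv, hf']
      · rw [comp_eq_zero (fun h' => h h'.symm) hv, map_zero, map_zero]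
  obtain ⟨f', hf', hc⟩ := key w
  refine ⟨comp (F.deg 0) j w, comp_mem _ _ _, ?_⟩
  have h := hI _ (Ideal.Quotient.eq.1 (hf'.symm.trans hw)) j
  rw [map_sub, homogeneousComponent_eq_self hf] at h
  rw [hc, Ideal.Quotient.eq]
  exact h

/-- The comparison theorem: graded chain maps lifting the identity exist. -/
theorem exists_chainMap (F G : GradedFreeResolution I)
    (hI : ∀ f ∈ I, ∀ j, homogeneousComponent j f ∈ I) :
    ∃ φ : ∀ i, (F.ι i → MvPolynomial σ K) →ₗ[MvPolynomial σ K] (G.ι i → MvPolynomial σ K),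
      (∀ i, IsGraded (F.deg i) (G.deg i) (φ i)) ∧
      (∀ i v, G.d i (φ (i + 1) v) = φ i (F.d i v)) ∧ ∀ v, G.aug (φ 0 v) = F.aug v := by
  have base : ∃ u : (F.ι 0 → MvPolynomial σ K) →ₗ[MvPolynomial σ K] (G.ι 0 → MvPolynomial σ K),
      IsGraded (F.deg 0) (G.deg 0) u ∧ G.aug ∘ₗ u = F.aug := by
    have : ∀ a, ∃ w ∈ gradedFreePiece (G.deg 0) (F.deg 0 a),
        G.aug w = F.aug (Pi.single a 1) := by
      intro a
      obtain ⟨f, hf, hf'⟩ := F.aug_graded _ _ (basis_mem_piece (F.deg 0) a)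
      rw [hf']
      exact G.exists_aug_eq hI hf
    choose w hw hw' using this
    obtain ⟨u, hu, hu'⟩ := exists_graded_map (F.deg 0) (G.deg 0) w hw
    exact ⟨u, hu, ext_basis fun a => by rw [LinearMap.comp_apply, hu', hw']⟩
  obtain ⟨u, hu, hu'⟩ := base
  -- The invariant of the recursion: boundaries go to boundaries, which is what makes the next lift
  -- possible.
  let Good : ∀ i, ((F.ι i → MvPolynomial σ K) →ₗ[MvPolynomial σ K]
      (G.ι i → MvPolynomial σ K)) → Prop := fun i φ =>
    IsGraded (F.deg i) (G.deg i) φ ∧ ∀ v, φ (F.d i v) ∈ LinearMap.range (G.d i)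
  have step : ∀ i (φ : {φ // Good i φ}), ∃ ψ : {ψ // Good (i + 1) ψ},
      ∀ v, G.d i (ψ.1 v) = φ.1 (F.d i v) := by
    rintro i ⟨φ, h1, h2⟩
    obtain ⟨ψ, h3, h4⟩ := exists_graded_lift (f := φ ∘ₗ F.d i) (h1.comp (F.d_graded i))
      (G.d_graded i) h2
    have h5 : ∀ v, G.d i (ψ v) = φ (F.d i v) := fun v => LinearMap.congr_fun h4 v
    refine ⟨⟨ψ, h3, fun v => ?_⟩, h5⟩
    rw [range_d_succ, h5, F.d_d, map_zero]
  choose next hnext using step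
  let Φ : ∀ i, {φ // Good i φ} := fun i => Nat.rec ⟨u, hu, fun v => by
    rw [range_d_zero, ← LinearMap.comp_apply, hu', ← range_d_zero]
    exact ⟨v, rfl⟩⟩ (fun i φ => next i φ) i
  exact ⟨fun i => (Φ i).1, fun i => (Φ i).2.1, fun i v => hnext i (Φ i) v,
    fun v => LinearMap.congr_fun hu' v⟩

/-- An endomorphism of a resolution that lifts zero is null-homotopic. -/
theorem exists_homotopy (F : GradedFreeResolution I)
    (θ : ∀ i, (F.ι i → MvPolynomial σ K) →ₗ[MvPolynomial σ K] (F.ι i → MvPolynomial σ K))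
    (hθ : ∀ i v, F.d i (θ (i + 1) v) = θ i (F.d i v)) (h0 : ∀ v, F.aug (θ 0 v) = 0) :
    ∃ h : ∀ i, (F.ι i → MvPolynomial σ K) →ₗ[MvPolynomial σ K] (F.ι (i + 1) → MvPolynomial σ K),
      θ 0 = F.d 0 ∘ₗ h 0 ∧ ∀ i, θ (i + 1) = F.d (i + 1) ∘ₗ h (i + 1) + h i ∘ₗ F.d i := by
  obtain ⟨u, hu⟩ := exists_lift (θ 0) (F.d 0) (fun v => F.range_d_zero.2 (h0 v))
  let Good : ∀ i, ((F.ι i → MvPolynomial σ K) →ₗ[MvPolynomial σ K]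
      (F.ι (i + 1) → MvPolynomial σ K)) → Prop := fun i h =>
    ∀ v, F.d i (h (F.d i v)) = θ i (F.d i v)
  have step : ∀ i (h : {h // Good i h}), ∃ h' : {h' // Good (i + 1) h'},
      θ (i + 1) = F.d (i + 1) ∘ₗ h'.1 + h.1 ∘ₗ F.d i := by
    rintro i ⟨h, h1⟩
    obtain ⟨h', h2⟩ := exists_lift (θ (i + 1) - h ∘ₗ F.d i) (F.d (i + 1)) (fun v => by
      rw [range_d_succ, LinearMap.sub_apply, map_sub, LinearMap.comp_apply, h1, hθ, sub_self])
    refine ⟨⟨h', fun v => ?_⟩, by rw [h2, sub_add_cancel]⟩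
    rw [← LinearMap.comp_apply, h2, LinearMap.sub_apply, LinearMap.comp_apply, F.d_d, map_zero,
      sub_zero]
  choose next hnext using step
  let H : ∀ i, {h // Good i h} := fun i => Nat.rec
    ⟨u, fun v => by rw [← LinearMap.comp_apply, hu]⟩ (fun i h => next i h) i
  exact ⟨fun i => (H i).1, hu.symm, fun i => hnext i (H i)⟩

/-- The differential modulo the variables, in degree `n`. -/
noncomputable def redD (F : GradedFreeResolution I) (n i : ℕ) :
    ({a // F.deg (i + 1) a = n} → K) →ₗ[K] ({a // F.deg i a = n} → K) :=
  red (F.deg (i + 1)) (F.deg i) n (F.d i)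

end GradedFreeResolution

/-! ### Betti numbers as homology of a reduced resolution -/

namespace MinimalGradedFreeResolution

variable {σ K : Type*} [Field K] {I : Ideal (MvPolynomial σ K)}

theorem redD_eq_zero (F : MinimalGradedFreeResolution I) (n i : ℕ) :
    F.toGradedFreeResolution.redD n i = 0 := by
  have h : ∀ p ∈ Ideal.span (Set.range (X : σ → MvPolynomial σ K)), constantCoeff p = 0 := by
    have : Ideal.span (Set.range (X : σ → MvPolynomial σ K)) ≤
        RingHom.ker (constantCoeff : MvPolynomial σ K →+* K) := by
      rw [Ideal.span_le]
      rintro _ ⟨i, rfl⟩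
      simp
    exact fun p hp => this hp
  ext v b
  simp only [GradedFreeResolution.redD, LinearMap.comp_apply, red_apply]
  refine Finset.sum_eq_zero fun a _ => ?_
  exact mul_eq_zero_of_left (h _ (F.minimal i _ b.1)) _

theorem finrank_eq_betti (F : MinimalGradedFreeResolution I) (n i : ℕ) :
    Module.finrank K ({a // F.toGradedFreeResolution.deg i a = n} → K) = F.betti i n := by
  rw [Module.finrank_fintype_fun_eq_card]
  exact Fintype.card_subtype _

/-- Maps between the reductions of a minimal resolution and an arbitrary one, inverse to each other
up to homotopy. -/
theorem exists_reduced_maps (F : MinimalGradedFreeResolution I) (G : GradedFreeResolution I)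
    (hI : ∀ f ∈ I, ∀ j, homogeneousComponent j f ∈ I) (n : ℕ) :
    ∃ (φ : ∀ i, ({a // F.toGradedFreeResolution.deg i a = n} → K) →ₗ[K]
        ({a // G.deg i a = n} → K))
      (ψ : ∀ i, ({a // G.deg i a = n} → K) →ₗ[K]
        ({a // F.toGradedFreeResolution.deg i a = n} → K)),
      (∀ i v, ψ i (φ i v) = v) ∧ (∀ i v, G.redD n i (φ (i + 1) v) = 0) ∧
      (∀ i v, ψ i (G.redD n i v) = 0) ∧
      ∀ i v, G.redD n i v = 0 → φ (i + 1) (ψ (i + 1) v) - v ∈ LinearMap.range (G.redD n (i + 1)) := by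
  set F' := F.toGradedFreeResolution with hF'
  have hmin : ∀ i, red (F'.deg (i + 1)) (F'.deg i) n (F'.d i) = 0 := F.redD_eq_zero n
  obtain ⟨φ, hφ, hφd, hφa⟩ := F'.exists_chainMap G hI
  obtain ⟨ψ, hψ, hψd, hψa⟩ := G.exists_chainMap F' hI
  obtain ⟨h, h0, h1⟩ := F'.exists_homotopy (fun i => ψ i ∘ₗ φ i - LinearMap.id)
    (fun i v => by simp [hψd, hφd]) (fun v => by simp [hψa, hφa])
  obtain ⟨k, k0, k1⟩ := G.exists_homotopy (fun i => φ i ∘ₗ ψ i - LinearMap.id)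
    (fun i v => by simp [hψd, hφd]) (fun v => by simp [hψa, hφa])
  have hφr : ∀ i, G.redD n i ∘ₗ red (F'.deg _) (G.deg _) n (φ (i + 1)) = 0 := by
    intro i
    rw [GradedFreeResolution.redD, ← red_comp_of_left (G.d_graded i),
      show G.d i ∘ₗ φ (i + 1) = φ i ∘ₗ F'.d i from LinearMap.ext (hφd i),
      red_comp_of_left (hφ i), hmin, LinearMap.comp_zero]
  have hψr : ∀ i, red (G.deg _) (F'.deg _) n (ψ i) ∘ₗ G.redD n i = 0 := by
    intro i
    rw [GradedFreeResolution.redD, ← red_comp_of_left (hψ i),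
      ← show F'.d i ∘ₗ ψ (i + 1) = ψ i ∘ₗ G.d i from LinearMap.ext (hψd i),
      red_comp_of_left (F'.d_graded i), hmin, LinearMap.zero_comp]
  -- Both terms of the homotopy contain a differential of the minimal resolution, which vanishes
  -- modulo the variables; so the homotopy equivalence becomes a strict left inverse.
  have hψφ : ∀ i, red (G.deg _) (F'.deg _) n (ψ i) ∘ₗ red (F'.deg _) (G.deg _) n (φ i) - LinearMap.id = 0 := by
    intro i
    rw [← red_comp_of_left (hψ i), ← red_id, ← red_sub]
    cases i with
    | zero => rw [h0, red_comp_of_left (F'.d_graded 0), hmin, LinearMap.zero_comp]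
    | succ i =>
      rw [h1, red_add, red_comp_of_left (F'.d_graded _), red_comp_of_right (F'.d_graded _), hmin,
        hmin, LinearMap.zero_comp, LinearMap.comp_zero, add_zero]
  refine ⟨fun i => red (F'.deg _) (G.deg _) n (φ i), fun i => red (G.deg _) (F'.deg _) n (ψ i), fun i v => ?_,
    fun i v => LinearMap.congr_fun (hφr i) v, fun i v => LinearMap.congr_fun (hψr i) v,
    fun i v hv => ?_⟩
  · exact sub_eq_zero.1 (LinearMap.congr_fun (hψφ i) v)
  · refine ⟨red (G.deg _) (G.deg _) n (k (i + 1)) v, ?_⟩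
    have : red (F'.deg _) (G.deg _) n (φ (i + 1)) ∘ₗ red (G.deg _) (F'.deg _) n (ψ (i + 1)) - LinearMap.id =
        G.redD n (i + 1) ∘ₗ red (G.deg _) (G.deg _) n (k (i + 1)) + red (G.deg _) (G.deg _) n (k i) ∘ₗ G.redD n i := by
      rw [← red_comp_of_left (hφ _), ← red_id, ← red_sub, k1, red_add,
        red_comp_of_left (G.d_graded _), red_comp_of_right (G.d_graded _)]
      rfl
    have h2 := LinearMap.congr_fun this v
    rw [LinearMap.add_apply, LinearMap.comp_apply (red (G.deg _) (G.deg _) n (k i)), hv, map_zero, add_zero] at h2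
    exact h2.symm

/-- The cycles split as `Z = φ(V) ⊕ B`: the sum is all of `Z` because `φ ∘ ψ` is the identity modulo
`B`, and it is direct because `ψ` kills `B` and inverts `φ`. -/
theorem finrank_add_finrank_eq {K V W : Type*} [Field K] [AddCommGroup V] [Module K V]
    [AddCommGroup W] [Module K W] [FiniteDimensional K V] [FiniteDimensional K W]
    (Z B : Submodule K W) (hBZ : B ≤ Z) (φ : V →ₗ[K] W) (ψ : W →ₗ[K] V)
    (h1 : ∀ v, ψ (φ v) = v) (h2 : ∀ v, φ v ∈ Z) (h3 : ∀ w ∈ B, ψ w = 0)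
    (h4 : ∀ w ∈ Z, φ (ψ w) - w ∈ B) :
    Module.finrank K V + Module.finrank K B = Module.finrank K Z := by
  have hinj : Function.Injective φ := Function.LeftInverse.injective h1
  have hsup : LinearMap.range φ ⊔ B = Z := by
    apply le_antisymm
    · refine sup_le ?_ hBZ
      rintro _ ⟨v, rfl⟩
      exact h2 v
    · intro w hw
      rw [Submodule.mem_sup]
      refine ⟨φ (ψ w), ⟨_, rfl⟩, _, B.neg_mem (h4 w hw), by abel⟩
  have hinf : LinearMap.range φ ⊓ B = ⊥ := by
    rw [eq_bot_iff]
    rintro _ ⟨⟨v, rfl⟩, hv⟩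
    have := h3 _ hv
    rw [h1] at this
    simp [this]
  have := Submodule.finrank_sup_add_finrank_inf_eq (LinearMap.range φ) B
  rw [hsup, hinf, finrank_bot, add_zero, LinearMap.finrank_range_of_inj hinj] at this
  exact this.symm

theorem betti_succ_add (F : MinimalGradedFreeResolution I) (G : GradedFreeResolution I)
    (hI : ∀ f ∈ I, ∀ j, homogeneousComponent j f ∈ I) (n i : ℕ) :
    F.betti (i + 1) n + Module.finrank K (LinearMap.range (G.redD n (i + 1))) =
      Module.finrank K (LinearMap.ker (G.redD n i)) := by
  obtain ⟨φ, ψ, h1, h2, h3, h4⟩ := F.exists_reduced_maps G hI n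
  rw [← F.finrank_eq_betti]
  refine finrank_add_finrank_eq _ _ ?_ (φ (i + 1)) (ψ (i + 1)) (h1 _) (h2 i) ?_ (h4 i)
  · rw [LinearMap.range_le_ker_iff, GradedFreeResolution.redD, GradedFreeResolution.redD,
      ← red_comp_of_left (G.d_graded i), ← red_zero]
    exact congrArg _ (LinearMap.ext (G.d_d i))
  · rintro _ ⟨w, rfl⟩
    exact h3 _ w

/-- Homological degree `0` has no outgoing differential in `redD`, so it is treated separately: the
space injects into a zero space. -/
theorem betti_zero_eq_zero (F : MinimalGradedFreeResolution I) (G : GradedFreeResolution I)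
    (hI : ∀ f ∈ I, ∀ j, homogeneousComponent j f ∈ I) (n : ℕ) (h : ∀ a, G.deg 0 a ≠ n) :
    F.betti 0 n = 0 := by
  obtain ⟨φ, ψ, h1, -⟩ := F.exists_reduced_maps G hI n
  rw [← F.finrank_eq_betti]
  have : IsEmpty {a // G.deg 0 a = n} := ⟨fun a => h _ a.2⟩
  have hz : ∀ v : {a // F.toGradedFreeResolution.deg 0 a = n} → K, v = 0 := fun v => by
    rw [← h1 0 v, Subsingleton.elim (φ 0 v) 0, map_zero]
  have : Subsingleton ({a // F.toGradedFreeResolution.deg 0 a = n} → K) :=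
    ⟨fun v w => (hz v).trans (hz w).symm⟩
  exact Module.finrank_zero_of_subsingleton

end MinimalGradedFreeResolution

/-! ### The Taylor resolution of a monomial ideal -/

namespace Taylor

section Boundary

variable {α K : Type*} [Fintype α] [LinearOrder α] [Field K]

/-- The incidence sign of `A` in `insert x A`. -/
def sgn (K : Type*) [Field K] (A : Finset α) (x : α) : K := (-1) ^ (A.filter (· < x)).card

theorem sgn_ne_zero (A : Finset α) (x : α) : sgn K A x ≠ 0 :=
  pow_ne_zero _ (neg_ne_zero.2 one_ne_zero)

theorem sgn_insert {A : Finset α} {y : α} (hy : y ∉ A) (x : α) :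
    sgn K (insert y A) x = if y < x then -sgn K A x else sgn K A x := by
  unfold sgn
  rw [Finset.filter_insert]
  split_ifs with h
  · rw [Finset.card_insert_of_notMem (by simp [hy]), pow_succ]
    ring
  · rfl

theorem sgn_eq_one {A : Finset α} {x : α} (h : ∀ y ∈ A, x ≤ y) : sgn K A x = 1 := by
  unfold sgn
  rw [Finset.filter_false_of_mem (fun y hy => not_lt.2 (h y hy))]
  simp

/-- The boundary operator of the augmented simplicial chain complex of a full simplex. -/
def boundary (g : Finset α → K) (A : Finset α) : K := ∑ x ∈ Aᶜ, sgn K A x * g (insert x A)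

theorem boundary_boundary (g : Finset α → K) : boundary (boundary g) = 0 := by
  funext A
  simp only [boundary, Finset.mul_sum, Pi.zero_apply]
  rw [Finset.sum_sigma']
  -- The terms adding `x` then `y` and `y` then `x` cancel: exactly one of the two signs changes.
  refine Finset.sum_involution (fun p _ => ⟨p.2, p.1⟩) ?_ ?_ ?_ ?_
  · rintro ⟨x, y⟩ h
    simp only [Finset.mem_sigma, Finset.mem_compl, Finset.mem_insert, not_or] at h
    obtain ⟨hx, hyx, hy⟩ := h
    simp only [sgn_insert hx, sgn_insert hy, Finset.insert_comm x y]
    rcases lt_or_gt_of_ne hyx with h | h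
    · simp only [h, not_lt_of_gt h, if_true, if_false]
      ring
    · simp only [h, not_lt_of_gt h, if_true, if_false]
      ring
  · rintro ⟨x, y⟩ h _ h'
    simp only [Finset.mem_sigma, Finset.mem_compl, Finset.mem_insert, not_or] at h
    simp only [Sigma.mk.injEq] at h'
    exact h.2.1 h'.1
  · rintro ⟨x, y⟩ h
    simp only [Finset.mem_sigma, Finset.mem_compl, Finset.mem_insert, not_or] at h ⊢
    exact ⟨h.2.2, Ne.symm h.2.1, h.1⟩
  · rintro ⟨x, y⟩ h
    rfl

/-- Coning with a vertex below all vertices of the support is a contracting homotopy on cycles.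
Minimality of `x₀` gives the sign `1` for adding `x₀` and flips the sign of every other vertex once
`x₀` is present. -/
theorem boundary_cone (g : Finset α → K) (hg : boundary g = 0) (x₀ : α)
    (h₀ : ∀ A, g A ≠ 0 → ∀ x ∈ A, x₀ ≤ x) :
    boundary (fun A => if x₀ ∈ A then g (A.erase x₀) else 0) = g := by
  have hs : ∀ A x, (∀ y ∈ insert x A, g (insert x A) ≠ 0 → x ≤ y) →
      sgn K A x * g (insert x A) = g (insert x A) := by
    intro A x h
    by_cases hz : g (insert x A) = 0
    · rw [hz, mul_zero]
    · rw [sgn_eq_one fun y hy => h y (Finset.mem_insert_of_mem hy) hz, one_mul]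
  funext A
  by_cases hA : x₀ ∈ A
  · obtain ⟨B, hB, rfl⟩ : ∃ B, x₀ ∉ B ∧ A = insert x₀ B :=
      ⟨A.erase x₀, Finset.notMem_erase _ _, (Finset.insert_erase hA).symm⟩
    have h1 := congrFun hg B
    have h2 : Bᶜ = insert x₀ (insert x₀ B)ᶜ := by
      ext y
      by_cases h : y = x₀ <;> simp [h, hB]
    rw [boundary, h2, Finset.sum_insert (by simp),
      hs B x₀ (fun y hy hz => h₀ _ hz y hy), Pi.zero_apply, add_eq_zero_iff_eq_neg] at h1
    rw [h1, boundary, ← Finset.sum_neg_distrib]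
    refine Finset.sum_congr rfl fun x hx => ?_
    simp only [Finset.mem_compl, Finset.mem_insert, not_or] at hx
    rw [if_pos (by simp), Finset.insert_comm, Finset.erase_insert (by simp [Ne.symm hx.1, hB])]
    by_cases hz : g (insert x B) = 0
    · simp [hz]
    · have : x₀ < x := lt_of_le_of_ne (h₀ _ hz x (by simp)) (Ne.symm hx.1)
      rw [sgn_insert hB, if_pos this, neg_mul]
  · rw [boundary, Finset.sum_eq_single x₀]
    · rw [if_pos (by simp), Finset.erase_insert hA]
      by_cases hz : g A = 0
      · rw [hz, mul_zero]
      · rw [sgn_eq_one (h₀ _ hz), one_mul]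
    · intro x _ hx
      rw [if_neg (by simp [hA, Ne.symm hx]), mul_zero]
    · intro h
      exact absurd (Finset.mem_compl.2 hA) h

end Boundary

section Total

variable {α σ K : Type*} [Fintype α] [LinearOrder α] [Field K] (m : α → σ →₀ ℕ)

/-- The strand of a vector in the multidegree `w`. -/
noncomputable def strand (v : Finset α → MvPolynomial σ K) (w : σ →₀ ℕ) (A : Finset α) : K :=
  if A.sup m ≤ w then coeff (w - A.sup m) (v A) else 0

/-- The differential of the Taylor complex of the monomials with exponents `m x`. -/
noncomputable def diff :
    (Finset α → MvPolynomial σ K) →ₗ[MvPolynomial σ K] (Finset α → MvPolynomial σ K) :=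
  LinearMap.pi fun A => ∑ x ∈ Aᶜ,
    monomial ((insert x A).sup m - A.sup m) (sgn K A x) • LinearMap.proj (insert x A)

theorem diff_apply (v : Finset α → MvPolynomial σ K) (A : Finset α) :
    diff m v A = ∑ x ∈ Aᶜ,
      monomial ((insert x A).sup m - A.sup m) (sgn K A x) * v (insert x A) := by
  simp [diff]

theorem sup_le_sup_insert (x : α) (A : Finset α) : A.sup m ≤ (insert x A).sup m :=
  Finset.sup_mono (Finset.subset_insert x A)

/-- In each multidegree `w` the Taylor complex is the simplicial chain complex of the full simplex
on the generators dividing `x^w`, so exactness can be checked strand by strand. -/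
theorem strand_diff (v : Finset α → MvPolynomial σ K) (w : σ →₀ ℕ) :
    strand m (diff m v) w = boundary (strand m v w) := by
  funext A
  unfold strand boundary
  by_cases h : A.sup m ≤ w
  · rw [if_pos h, diff_apply, coeff_sum]
    refine Finset.sum_congr rfl fun x _ => ?_
    have h1 := sup_le_sup_insert m x A
    rw [coeff_monomial_mul', mul_ite, mul_zero]
    have h2 : (insert x A).sup m - A.sup m ≤ w - A.sup m ↔ (insert x A).sup m ≤ w :=
      by
      rw [tsub_le_iff_right, tsub_add_cancel_of_le h]
    by_cases h3 : (insert x A).sup m ≤ w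
    · rw [if_pos (h2.2 h3), if_pos h3, tsub_tsub_tsub_cancel_right h1]
    · rw [if_neg (fun h4 => h3 (h2.1 h4)), if_neg h3]
  · rw [if_neg h]
    symm
    refine Finset.sum_eq_zero fun x _ => ?_
    simp only [if_neg (fun h4 => h ((sup_le_sup_insert m x A).trans h4)), mul_zero]

theorem ext_strand {v v' : Finset α → MvPolynomial σ K}
    (h : ∀ w, strand m v w = strand m v' w) : v = v' := by
  ext A e
  simpa [strand] using congrFun (h (e + A.sup m)) A

theorem diff_diff (v : Finset α → MvPolynomial σ K) : diff m (diff m v) = 0 := by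
  refine ext_strand m fun w => ?_
  rw [strand_diff, strand_diff, boundary_boundary]
  funext A
  simp [strand]

theorem exists_coeff_eq_ite (p : MvPolynomial σ K) (P : (σ →₀ ℕ) → Prop) [DecidablePred P] :
    ∃ q : MvPolynomial σ K, ∀ e, coeff e q = if P e then coeff e p else 0 := by
  classical
  refine ⟨∑ e ∈ p.support.filter P, monomial e (coeff e p), fun e => ?_⟩
  rw [coeff_sum]
  simp only [coeff_monomial, Finset.sum_ite_eq', Finset.mem_filter, mem_support_iff]
  by_cases h : coeff e p = 0 <;> simp [h]

/-- The cones in the various multidegrees use different apexes, namely the least generator dividing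
`x^w`. Since vectors have finite support, all these cones together still form a vector of
polynomials. -/
theorem exists_contraction (v : Finset α → MvPolynomial σ K) :
    ∃ u : Finset α → MvPolynomial σ K, ∀ w x₀, IsLeast {x | m x ≤ w} x₀ →
      strand m u w = fun A => if x₀ ∈ A then strand m v w (A.erase x₀) else 0 := by
  classical
  -- `q A x` collects the terms of entry `A` from those multidegrees `A.sup m + e` whose apex is
  -- `x`.
  have h1 : ∀ (A : Finset α) (x : α), ∃ q : MvPolynomial σ K, ∀ e, coeff e q =
      if IsLeast {y | m y ≤ A.sup m + e} x then
        coeff (A.sup m - (A.erase x).sup m + e) (v (A.erase x)) else 0 := by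
    intro A x
    obtain ⟨q, hq⟩ := exists_coeff_eq_ite
      ((v (A.erase x)).divMonomial (A.sup m - (A.erase x).sup m))
      (fun e => IsLeast {y | m y ≤ A.sup m + e} x)
    exact ⟨q, fun e => by rw [hq, coeff_divMonomial]⟩
  choose q hq using h1
  refine ⟨fun A => ∑ x ∈ A, q A x, fun w x₀ h₀ => ?_⟩
  funext A
  unfold strand
  by_cases hA : A.sup m ≤ w
  · rw [if_pos hA, coeff_sum]
    simp only [hq, add_tsub_cancel_of_le hA]
    have h2 : ∀ x, IsLeast {y | m y ≤ w} x ↔ x = x₀ :=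
      fun x => ⟨fun h => h.unique h₀, fun h => h ▸ h₀⟩
    simp only [h2, Finset.sum_ite_eq']
    have h3 : (A.erase x₀).sup m ≤ A.sup m := Finset.sup_mono (Finset.erase_subset _ _)
    rw [if_pos (h3.trans hA), add_comm (A.sup m - _), tsub_add_tsub_cancel hA h3]
  · rw [if_neg hA]
    split_ifs with h3 h4
    · refine absurd ?_ hA
      rw [← Finset.insert_erase h3, Finset.sup_insert]
      exact sup_le h₀.1 h4
    · rfl
    · rfl

theorem exists_diff_eq (v : Finset α → MvPolynomial σ K) (hv : diff m v = 0)
    (h0 : v ∅ ∈ Ideal.span (Set.range fun x => monomial (m x) (1 : K))) :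
    ∃ u, diff m u = v := by
  obtain ⟨u, hu⟩ := exists_contraction m v
  refine ⟨u, ext_strand m fun w => ?_⟩
  rw [strand_diff]
  by_cases h : ∃ x, m x ≤ w
  · have hne : (Finset.univ.filter fun x => m x ≤ w).Nonempty := by
      obtain ⟨x, hx⟩ := h
      exact ⟨x, by simpa using hx⟩
    have hleast : IsLeast {x | m x ≤ w} ((Finset.univ.filter fun x => m x ≤ w).min' hne) := by
      have := Finset.isLeast_min' _ hne
      simpa using this
    rw [hu w _ hleast]
    refine boundary_cone _ ?_ _ ?_
    · rw [← strand_diff, hv]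
      funext A
      simp [strand]
    · intro A hA x hx
      refine hleast.2 ?_
      by_contra hxw
      refine hA ?_
      rw [strand, if_neg (fun h => hxw ((Finset.le_sup hx).trans h))]
  -- No generator divides `x^w`, so the strand lives on `∅` alone, and there its coefficient
  -- vanishes because `v ∅` lies in the ideal.
  · have hz : ∀ (v : Finset α → MvPolynomial σ K) (A : Finset α), A.Nonempty →
        strand m v w A = 0 := by
      rintro v A ⟨x, hx⟩
      rw [strand, if_neg (fun h' => h ⟨x, (Finset.le_sup hx).trans h'⟩)]
    funext A
    rw [boundary, Finset.sum_eq_zero fun x _ => by rw [hz _ _ ⟨x, by simp⟩, mul_zero]]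
    rcases A.eq_empty_or_nonempty with rfl | hA
    · rw [show (Set.range fun x => monomial (m x) (1 : K)) =
        (fun s => monomial s 1) '' Set.range m from Set.range_comp (fun s => monomial s 1) m] at h0
      have h1 := mem_ideal_span_monomial_image.1 h0 w
      rw [strand, Finset.sup_empty, if_pos bot_le]
      by_contra h2
      have h3 : coeff w (v ∅) ≠ 0 := by
        simpa [bot_eq_zero] using Ne.symm h2
      obtain ⟨_, ⟨x, rfl⟩, hx⟩ := h1 (mem_support_iff.2 h3)
      exact h ⟨x, hx⟩
    · rw [hz _ _ hA]

end Total

section Graded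

variable {α : Type} {σ K : Type*} [Fintype α] [LinearOrder α] [Field K] (m : α → σ →₀ ℕ)

/-- Extension by zero from the subsets of cardinality `i`. -/
noncomputable def extend (i : ℕ) : ({S : Finset α // S.card = i} → MvPolynomial σ K) →ₗ[MvPolynomial σ K]
    (Finset α → MvPolynomial σ K) :=
  LinearMap.pi fun S => if h : S.card = i then LinearMap.proj ⟨S, h⟩ else 0

/-- Restriction to the subsets of cardinality `i`. -/
noncomputable def restrict (i : ℕ) : (Finset α → MvPolynomial σ K) →ₗ[MvPolynomial σ K]
    ({S : Finset α // S.card = i} → MvPolynomial σ K) :=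
  LinearMap.pi fun S => LinearMap.proj S.1

theorem extend_apply {i : ℕ} (v : {S : Finset α // S.card = i} → MvPolynomial σ K)
    {S : Finset α} (h : S.card = i) : extend i v S = v ⟨S, h⟩ := by
  simp [extend, h]

theorem extend_apply_of_ne {i : ℕ} (v : {S : Finset α // S.card = i} → MvPolynomial σ K)
    {S : Finset α} (h : S.card ≠ i) : extend i v S = 0 := by
  simp [extend, h]

theorem restrict_extend {i : ℕ} (v : {S : Finset α // S.card = i} → MvPolynomial σ K) :
    restrict i (extend i v) = v := by
  funext S
  exact extend_apply v S.2

theorem restrict_apply {i : ℕ} (v : Finset α → MvPolynomial σ K) (S : {S : Finset α // S.card = i}) :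
    restrict i v S = v S.1 := rfl

/-- The differential of the Taylor complex. -/
noncomputable def d (i : ℕ) :
    ({S : Finset α // S.card = i + 1} → MvPolynomial σ K) →ₗ[MvPolynomial σ K]
    ({S : Finset α // S.card = i} → MvPolynomial σ K) :=
  restrict i ∘ₗ diff m ∘ₗ extend (i + 1)

theorem extend_d (i : ℕ) (v : {S : Finset α // S.card = i + 1} → MvPolynomial σ K) :
    extend i (d m i v) = diff m (extend (i + 1) v) := by
  funext A
  by_cases h : A.card = i
  · rw [extend_apply _ h]
    rfl
  · rw [extend_apply_of_ne _ h, diff_apply]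
    symm
    refine Finset.sum_eq_zero fun x hx => ?_
    rw [extend_apply_of_ne, mul_zero]
    rw [Finset.card_insert_of_notMem (by simpa using hx)]
    omega

theorem extend_injective (i : ℕ) : Function.Injective
    (extend (α := α) (σ := σ) (K := K) i) :=
  Function.LeftInverse.injective restrict_extend

theorem diff_extend_restrict (i : ℕ) (u : Finset α → MvPolynomial σ K)
    {v : {S : Finset α // S.card = i} → MvPolynomial σ K} (h : diff m u = extend i v) :
    d m i (restrict (i + 1) u) = v := by
  funext A
  rw [← extend_apply v A.2, ← h, ← extend_apply (d m i _) A.2, extend_d, diff_apply, diff_apply]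
  refine Finset.sum_congr rfl fun x hx => ?_
  have : (insert x A.1).card = i + 1 := by
    rw [Finset.card_insert_of_notMem (by simpa using hx), A.2]
  rw [extend_apply _ this, restrict_apply]

theorem isGraded_d (i : ℕ) : IsGraded (fun S : {S : Finset α // S.card = i + 1} => (S.1.sup m).degree)
    (fun S : {S : Finset α // S.card = i} => (S.1.sup m).degree) (d (K := K) m i) := by
  intro j v hv
  rw [mem_piece] at *
  intro A e he
  rw [← extend_apply (d m i v) A.2, extend_d, diff_apply, coeff_sum] at he
  obtain ⟨x, hx, hne⟩ := Finset.exists_ne_zero_of_sum_ne_zero he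
  have hc : (insert x A.1).card = i + 1 := by
    rw [Finset.card_insert_of_notMem (by simpa using hx), A.2]
  rw [extend_apply _ hc, coeff_monomial_mul'] at hne
  split_ifs at hne with hle
  · have h1 := hv _ _ (right_ne_zero_of_mul hne)
    have h2 := sup_le_sup_insert m x A.1
    have h3 := congrArg Finsupp.degree (tsub_add_cancel_of_le hle)
    have h4 := congrArg Finsupp.degree (tsub_add_cancel_of_le h2)
    rw [map_add] at h3 h4
    simp only at h1 ⊢
    omega
  · exact absurd rfl hne

/-- The Taylor resolution of a monomial ideal. -/
noncomputable def resolution :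
    GradedFreeResolution (Ideal.span (Set.range fun x => monomial (m x) (1 : K))) where
  ι i := {S : Finset α // S.card = i}
  deg i S := (S.1.sup m).degree
  d i := d m i
  aug := Submodule.mkQ _ ∘ₗ LinearMap.proj ⟨∅, Finset.card_empty⟩
  d_graded i := isGraded_d m i
  aug_graded := by
    intro j v hv
    refine ⟨v ⟨∅, Finset.card_empty⟩, fun e he => ?_, rfl⟩
    have h := mem_piece.1 hv _ _ he
    rw [Finset.sup_empty, bot_eq_zero, map_zero, add_zero] at h
    rw [← h, Finsupp.degree_eq_weight_one]
    rfl
  aug_surjective := by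
    intro f
    obtain ⟨f, rfl⟩ := Submodule.mkQ_surjective _ f
    exact ⟨fun _ => f, rfl⟩
  exact_zero := by
    intro v
    rw [LinearMap.comp_apply, Submodule.mkQ_apply, Submodule.Quotient.mk_eq_zero,
      LinearMap.proj_apply]
    constructor
    · intro hv
      obtain ⟨u, hu⟩ := exists_diff_eq m (extend 0 v) (by
        funext A
        rw [diff_apply]
        refine Finset.sum_eq_zero fun x _ => ?_
        rw [extend_apply_of_ne _ (by simp), mul_zero]) (by rwa [extend_apply _ Finset.card_empty])
      exact ⟨_, diff_extend_restrict m 0 u hu⟩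
    · rintro ⟨u, rfl⟩
      rw [← extend_apply (d m 0 u) Finset.card_empty, extend_d, diff_apply]
      refine Ideal.sum_mem _ fun x _ => Ideal.mul_mem_right _ _ ?_
      have : monomial ((insert x ∅ : Finset α).sup m - (∅ : Finset α).sup m) (sgn K ∅ x) =
          C (sgn K ∅ x) * monomial (m x) (1 : K) := by
        simp [C_mul_monomial, bot_eq_zero]
      rw [this]
      exact Ideal.mul_mem_left _ _ (Ideal.subset_span ⟨x, rfl⟩)
  exact_succ := by
    intro i v
    constructor
    · intro hv
      obtain ⟨u, hu⟩ := exists_diff_eq m (extend (i + 1) v) (by rw [← extend_d, hv, map_zero])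
        (by rw [extend_apply_of_ne _ (by simp)]; exact Ideal.zero_mem _)
      exact ⟨_, diff_extend_restrict m _ u hu⟩
    · rintro ⟨u, rfl⟩
      refine extend_injective i ?_
      rw [extend_d, extend_d, diff_diff, map_zero]

theorem d_single {i : ℕ} (B : {S : Finset α // S.card = i + 1}) (A : {S : Finset α // S.card = i}) :
    d m i (Pi.single B (1 : MvPolynomial σ K)) A = ∑ x ∈ A.1ᶜ, if insert x A.1 = B.1 then
      monomial ((insert x A.1).sup m - A.1.sup m) (sgn K A.1 x) else 0 := by
  rw [← extend_apply (d m i _) A.2, extend_d, diff_apply]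
  refine Finset.sum_congr rfl fun x hx => ?_
  have hc : (insert x A.1).card = i + 1 := by
    rw [Finset.card_insert_of_notMem (by simpa using hx), A.2]
  rw [extend_apply _ hc, Pi.single_apply]
  by_cases h : insert x A.1 = B.1
  · rw [if_pos (Subtype.ext h), if_pos h, mul_one]
  · rw [if_neg (fun h' => h (congrArg Subtype.val h')), if_neg h, mul_zero]

theorem d_single_eq_zero {i : ℕ} (B : {S : Finset α // S.card = i + 1})
    (A : {S : Finset α // S.card = i}) (h : ¬ A.1 ⊆ B.1) :
    d m i (Pi.single B (1 : MvPolynomial σ K)) A = 0 := by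
  rw [d_single]
  refine Finset.sum_eq_zero fun x _ => if_neg fun h' => h ?_
  rw [← h']
  exact Finset.subset_insert _ _

/-- Nested sets with lcms of equal degree have equal lcms, so the monomial in this entry is `1` and
the entry is a sign. -/
theorem constantCoeff_d_single_ne_zero {i : ℕ} (B : {S : Finset α // S.card = i + 1})
    (A : {S : Finset α // S.card = i}) (h : A.1 ⊆ B.1)
    (hdeg : (A.1.sup m).degree = (B.1.sup m).degree) :
    constantCoeff (d m i (Pi.single B (1 : MvPolynomial σ K)) A) ≠ 0 := by
  have h1 : A.1.sup m = B.1.sup m := by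
    have h2 : A.1.sup m ≤ B.1.sup m := Finset.sup_mono h
    have h3 := congrArg Finsupp.degree (tsub_add_cancel_of_le h2)
    rw [map_add, hdeg, Nat.add_eq_right, Finsupp.degree_eq_zero_iff] at h3
    exact le_antisymm h2 (tsub_eq_zero_iff_le.1 h3)
  obtain ⟨x, hx, hB⟩ : ∃ x, x ∉ A.1 ∧ insert x A.1 = B.1 := by
    have : A.1.card < B.1.card := by rw [A.2, B.2]; omega
    obtain ⟨x, hxB, hxA⟩ := Finset.exists_mem_notMem_of_card_lt_card this
    refine ⟨x, hxA, Finset.eq_of_subset_of_card_le (Finset.insert_subset hxB h) ?_⟩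
    rw [Finset.card_insert_of_notMem hxA, A.2, B.2]
  rw [d_single, Finset.sum_eq_single x]
  · rw [if_pos hB, hB, ← h1, tsub_self]
    simpa using sgn_ne_zero A.1 x
  · intro y hy hyx
    refine if_neg fun h' => ?_
    have : y ∈ insert x A.1 := by rw [hB, ← h']; simp
    rw [Finset.mem_insert] at this
    exact this.elim hyx (by simpa using hy)
  · intro h'
    exact absurd (Finset.mem_compl.2 hx) h'

end Graded

end Taylor

/-! ### An acyclic matching on the interval covers of a cycle -/

namespace CyclicCover

/-- The positions `x` congruent to `0` or to `e - k` modulo `t + 1`. -/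
def IsNode (t k e x : ℕ) : Prop := t + 1 ∣ x ∨ t + 1 ∣ x + (k - e)

theorem add_le_of_dvd {n a b : ℕ} (ha : n ∣ a) (hb : n ∣ b) (h : a < b) : a + n ≤ b := by
  have := Nat.le_of_dvd (Nat.sub_pos_of_lt h) (Nat.dvd_sub hb ha)
  omega

theorem isNode_zero (t k e : ℕ) : IsNode t k e 0 := Or.inl (dvd_zero _)

theorem IsNode.le_of_pos {t k e x : ℕ} (h : IsNode t k e x) (hx : 0 < x) :
    t + 1 ≤ x + (k - e) := by
  rcases h with h | h
  · exact (Nat.le_of_dvd hx h).trans (Nat.le_add_right _ _)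
  · exact Nat.le_of_dvd (by omega) h

/-- With `g = k - e` between `1` and `t`, the two residue classes `0` and `-g` alternate with gaps
`t + 1 - g` and `g`. So consecutive nodes are at most `t` apart, while nodes two steps apart are at
distance exactly `t + 1`. -/
theorem IsNode.exists_next {t k e x : ℕ} (he : e < k) (het : k ≤ e + t) (h : IsNode t k e x) :
    ∃ y, x < y ∧ y ≤ x + t ∧ IsNode t k e y ∧
      (∀ z, IsNode t k e z → z < x → z + (t + 1) ≤ y) ∧
      ∀ z, IsNode t k e z → z < y → z ≤ x := by
  obtain ⟨g, rfl⟩ := Nat.exists_eq_add_of_le he.le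
  simp only [IsNode, Nat.add_sub_cancel_left] at *
  have self : t + 1 ∣ t + 1 := dvd_rfl
  rcases h with h | h
  · have h' : t + 1 ∣ x + (t + 1) := dvd_add h self
    refine ⟨x + (t + 1 - g), by omega, by omega, Or.inr ?_, ?_, ?_⟩
    · rwa [show x + (t + 1 - g) + g = x + (t + 1) by omega]
    · rintro z (hz | hz) hzx
      · have := add_le_of_dvd hz h hzx
        omega
      · by_contra hlt
        have := add_le_of_dvd h hz (by omega)
        omega
    · rintro z (hz | hz) hzx
      · by_contra hlt
        have := add_le_of_dvd h hz (by omega)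
        omega
      · have := add_le_of_dvd hz h' (by omega)
        omega
  · refine ⟨x + g, by omega, by omega, Or.inl h, ?_, ?_⟩
    · rintro z (hz | hz) hzx
      · have := add_le_of_dvd hz h (by omega)
        omega
      · have := add_le_of_dvd hz h (by omega)
        omega
    · rintro z (hz | hz) hzx
      · have := add_le_of_dvd hz h (by omega)
        omega
      · by_contra hlt
        have := add_le_of_dvd h hz (by omega)
        omega

variable {t k : ℕ}

/-- The sets `S` of positions on a `k`-cycle such that every position `j` lies in one of the cyclic
intervals `{i, …, i + t - 1}` with `i ∈ S`. -/
def Cov (t : ℕ) {k : ℕ} (S : Finset (Fin k)) : Prop :=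
  ∀ j < k, ∃ i ∈ S, (i.1 ≤ j ∧ j < i.1 + t) ∨ j + k < i.1 + t

/-- The largest element of `S`. -/
def last (S : Finset (Fin k)) : ℕ := S.sup Fin.val

theorem le_last {S : Finset (Fin k)} {i : Fin k} (h : i ∈ S) : i.1 ≤ last S :=
  Finset.le_sup (f := Fin.val) h

theorem last_mem {S : Finset (Fin k)} (h : S.Nonempty) : ∃ i ∈ S, i.1 = last S := by
  obtain ⟨i, hi, h⟩ := Finset.exists_mem_eq_sup S h Fin.val
  exact ⟨i, hi, h.symm⟩

theorem last_mono {S S' : Finset (Fin k)} (h : S ⊆ S') : last S ≤ last S' := Finset.sup_mono h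

theorem Cov.nonempty {S : Finset (Fin k)} (h : Cov t S) (hk : 0 < k) : S.Nonempty := by
  obtain ⟨i, hi, -⟩ := h 0 hk
  exact ⟨i, hi⟩

theorem Cov.last_lt {S : Finset (Fin k)} (h : Cov t S) (hk : 0 < k) : last S < k := by
  obtain ⟨i, -, h⟩ := last_mem (h.nonempty hk)
  omega

theorem Cov.le_last_add {S : Finset (Fin k)} (h : Cov t S) (hk : 0 < k) : k ≤ last S + t := by
  obtain ⟨i, hi, h⟩ := h (k - 1) (by omega)
  have := le_last hi
  omega

theorem Cov.mono {S S' : Finset (Fin k)} (h : Cov t S) (hS : S ⊆ S') : Cov t S' := by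
  intro j hj
  obtain ⟨i, hi, h⟩ := h j hj
  exact ⟨i, hS hi, h⟩

/-- Let `y` be the node after `x`. Position `y - 1` must be covered from the window `y - t, …, y -
1`, whose only node is `x`. The wrapped interval of the last element does not reach it, since `y +
(k - last S) ≥ t + 1`. -/
theorem Cov.mem_of_isNode {S : Finset (Fin k)} (h : Cov t S) {x q : ℕ} (hqe : q ≤ last S)
    (hx : IsNode t k (last S) x) (hxq : x < q) (hq : IsNode t k (last S) q)
    (hS : ∀ i ∈ S, i.1 < q → IsNode t k (last S) i) : ∃ i ∈ S, i.1 = x := by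
  have hk : 0 < k := by
    by_contra h0
    obtain rfl : k = 0 := by omega
    have : S = ∅ := Finset.eq_empty_of_isEmpty S
    subst this
    simp [last] at hqe
    omega
  have he := h.last_lt hk
  obtain ⟨y, hxy, -, hy, h1, h2⟩ := hx.exists_next he (h.le_last_add hk)
  have hyq : y ≤ q := by
    by_contra hlt
    have := h2 q hq (by omega)
    omega
  obtain ⟨i, hi, hij⟩ := h (y - 1) (by omega)
  refine ⟨i, hi, ?_⟩
  have hil := le_last hi
  have hpos := hy.le_of_pos (by omega)
  rcases hij with ⟨h3, h4⟩ | h3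
  · have hiq := hS i hi (by omega)
    have h5 := h2 i hiq (by omega)
    by_contra hne
    have := h1 i hiq (by omega)
    omega
  · omega

/-- `q` is the last node before the first element of `S` that is not a node. -/
def IsPivot (t : ℕ) {k : ℕ} (S : Finset (Fin k)) (q : Fin k) : Prop :=
  ∃ s, IsLeast {x | x ∈ S ∧ ¬ IsNode t k (last S) x} s ∧
    IsGreatest {x : Fin k | x < s ∧ IsNode t k (last S) x} q

theorem IsPivot.unique {S : Finset (Fin k)} {q q' : Fin k} (h : IsPivot t S q)
    (h' : IsPivot t S q') : q = q' := by
  obtain ⟨s, hs, hq⟩ := h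
  obtain ⟨s', hs', hq'⟩ := h'
  obtain rfl := hs.unique hs'
  exact hq.unique hq'

/-- All elements of `S` are nodes. -/
def Critical (t : ℕ) {k : ℕ} (S : Finset (Fin k)) : Prop := ∀ i ∈ S, IsNode t k (last S) i

theorem IsPivot.not_critical {S : Finset (Fin k)} {q : Fin k} (h : IsPivot t S q) :
    ¬ Critical t S := by
  obtain ⟨s, hs, -⟩ := h
  exact fun h => hs.1.2 (h s hs.1.1)

theorem exists_isPivot {S : Finset (Fin k)} (h : ¬ Critical t S) : ∃ q, IsPivot t S q := by
  classical
  have h1 : (S.filter fun x : Fin k => ¬ IsNode t k (last S) x).Nonempty := by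
    unfold Critical at h
    push Not at h
    obtain ⟨i, hi, hn⟩ := h
    exact ⟨i, by simp [hi, hn]⟩
  obtain ⟨s, hs⟩ : ∃ s, IsLeast {x | x ∈ S ∧ ¬ IsNode t k (last S) x} s :=
    ⟨_, by simpa using Finset.isLeast_min' _ h1⟩
  have h2 : (Finset.univ.filter fun x : Fin k => x < s ∧ IsNode t k (last S) x).Nonempty := by
    refine ⟨⟨0, by have := s.2; omega⟩, ?_⟩
    simp only [Finset.mem_filter, Finset.mem_univ, true_and]
    refine ⟨?_, isNode_zero _ _ _⟩
    rw [Fin.lt_def]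
    refine Nat.pos_of_ne_zero fun h0 => hs.1.2 ?_
    rw [h0]
    exact isNode_zero _ _ _
  exact ⟨_, s, hs, by simpa using Finset.isGreatest_max' _ h2⟩

theorem IsPivot.last_erase {S : Finset (Fin k)} {q : Fin k} (h : IsPivot t S q) :
    last (S.erase q) = last S := by
  obtain ⟨s, hs, hq⟩ := h
  refine le_antisymm (last_mono (Finset.erase_subset _ _)) (Finset.sup_le fun i hi => ?_)
  by_cases hiq : i = q
  · subst hiq
    exact (Fin.le_def.1 (le_of_lt hq.1.1)).trans (le_last (Finset.mem_erase.2 ⟨ne_of_gt hq.1.1, hs.1.1⟩))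
  · exact le_last (Finset.mem_erase.2 ⟨hiq, hi⟩)

theorem IsPivot.last_lt {S : Finset (Fin k)} {q : Fin k} (h : IsPivot t S q) :
    q.1 < last S := by
  obtain ⟨s, hs, hq⟩ := h
  have := le_last hs.1.1
  have := Fin.lt_def.1 hq.1.1
  omega

/-- The pivot depends only on the last element and on the non-nodes of the set. As `q` is itself a
node, toggling it leaves the pivot unchanged, so the matching is an involution. -/
theorem isPivot_congr {S S' : Finset (Fin k)} {q : Fin k} (h : IsPivot t S q)
    (hlast : last S' = last S) (hS : S'.erase q = S.erase q) : IsPivot t S' q := by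
  obtain ⟨s, hs, hq⟩ := h
  refine ⟨s, ?_, by rwa [hlast]⟩
  have : {x | x ∈ S' ∧ ¬ IsNode t k (last S') x} = {x | x ∈ S ∧ ¬ IsNode t k (last S) x} := by
    ext x
    simp only [Set.mem_ofPred_eq, hlast, and_congr_left_iff]
    intro hx
    have hxq : x ≠ q := fun h => hx (h ▸ hq.1.2)
    have := congrArg (x ∈ ·) hS
    simpa [hxq] using this
  rwa [this]

theorem IsPivot.erase {S : Finset (Fin k)} {q : Fin k} (h : IsPivot t S q) :
    IsPivot t (S.erase q) q := isPivot_congr h h.last_erase (by simp)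

theorem IsPivot.insert {S : Finset (Fin k)} {q : Fin k} (h : IsPivot t S q) :
    IsPivot t (insert q S) q := by
  refine isPivot_congr h ?_ (by simp)
  unfold last
  rw [Finset.sup_insert]
  exact sup_eq_right.2 h.last_lt.le

/-- Positions from `s` on that `q` covered are covered by the first non-node `s`. The positions in
`[q, s)` end at or before `y - 2`, with `y` the node after `q`; they are covered by the node `y - (t
+ 1)`, or by the wrapped interval of the last element if there is no such node. -/
theorem Cov.erase {S : Finset (Fin k)} {q : Fin k} (h : Cov t S) (hp : IsPivot t S q) :
    Cov t (S.erase q) := by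
  have hk : 0 < k := by have := q.2; omega
  have hlast := hp.last_erase
  have hqe := hp.last_lt
  have hmem : ∃ i ∈ S.erase q, i.1 = last S := by
    obtain ⟨i, hi, hie⟩ := last_mem (h.nonempty hk)
    refine ⟨i, Finset.mem_erase.2 ⟨?_, hi⟩, hie⟩
    rintro rfl
    omega
  obtain ⟨e, he, hee⟩ := hmem
  obtain ⟨s, hs, hq⟩ := hp
  have hqs := Fin.lt_def.1 hq.1.1
  intro j hj
  obtain ⟨i, hi, hij⟩ := h j hj
  by_cases hiq : i = q
  swap
  · exact ⟨i, Finset.mem_erase.2 ⟨hiq, hi⟩, hij⟩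
  subst hiq
  rcases hij with ⟨h1, h2⟩ | h1
  swap
  · exact ⟨e, he, Or.inr (by omega)⟩
  by_cases hjs : s.1 ≤ j
  · exact ⟨s, Finset.mem_erase.2 ⟨ne_of_gt hq.1.1, hs.1.1⟩, Or.inl ⟨hjs, by omega⟩⟩
  have hel := h.last_lt hk
  have hke := h.le_last_add hk
  obtain ⟨y, hxy, hyt, hy, h3, h4⟩ := hq.1.2.exists_next hel hke
  -- `s` is not a node, and `q` is the greatest node below `s`, so the next node lies beyond `s`.
  have hsy : s.1 < y := by
    have hne : s.1 ≠ y := fun h => hs.1.2 (h ▸ hy)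
    by_contra hlt
    have := hq.2 (show (⟨y, by have := s.2; omega⟩ : Fin k) ∈ _ from
      ⟨Fin.lt_def.2 (by simp only; omega), hy⟩)
    have := Fin.le_def.1 this
    simp only at this
    omega
  by_cases hyt' : t + 1 ≤ y
  -- This node is below `q`, and all elements of `S` below `q` are nodes, so it belongs to `S`; its
  -- interval ends at `y - 2`.
  · have hz : IsNode t k (last S) (y - (t + 1)) := by
      refine hy.imp (fun h => ?_) (fun h => ?_)
      · exact Nat.dvd_sub h dvd_rfl
      · rw [show y - (t + 1) + (k - last S) = y + (k - last S) - (t + 1) by omega]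
        exact Nat.dvd_sub h dvd_rfl
    obtain ⟨z, hzS, hzy⟩ := h.mem_of_isNode hqe.le hz (by omega) hq.1.2 (by
      intro i' hi' hlt
      by_contra hn
      have := Fin.le_def.1 (hs.2 ⟨hi', hn⟩)
      omega)
    refine ⟨z, Finset.mem_erase.2 ⟨?_, hzS⟩, Or.inl (by omega)⟩
    rintro rfl
    omega
  -- Here `0 < y ≤ t` forces `y + (k - last S) = t + 1`, so the interval of the last element wraps
  -- around to end at `y - 2`.
  · refine ⟨e, he, Or.inr ?_⟩
    rcases hy with hy | hy
    · have := Nat.le_of_dvd (by omega) hy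
      omega
    · obtain ⟨c, hc⟩ := hy
      have : c < 2 := by
        by_contra hc2
        have : (t + 1) * 2 ≤ (t + 1) * c := Nat.mul_le_mul_left _ (by omega)
        omega
      interval_cases c <;> omega

/-- The matched sets that contain their pivot. -/
def Upper (t : ℕ) {k : ℕ} (S : Finset (Fin k)) : Prop := ∃ q ∈ S, IsPivot t S q

/-- The matched sets that do not contain their pivot. -/
def Lower (t : ℕ) {k : ℕ} (S : Finset (Fin k)) : Prop := ∃ q ∉ S, IsPivot t S q

theorem not_upper_iff {S : Finset (Fin k)} : ¬ Upper t S ↔ Lower t S ∨ Critical t S := by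
  constructor
  · intro h
    by_cases hc : Critical t S
    · exact Or.inr hc
    · obtain ⟨q, hq⟩ := exists_isPivot hc
      exact Or.inl ⟨q, fun hqS => h ⟨q, hqS, hq⟩, hq⟩
  · rintro (⟨q, hqS, hq⟩ | h) ⟨q', hqS', hq'⟩
    · exact hqS (hq.unique hq' ▸ hqS')
    · exact hq'.not_critical h

theorem Lower.not_critical {S : Finset (Fin k)} (h : Lower t S) : ¬ Critical t S := by
  obtain ⟨q, -, hq⟩ := h
  exact hq.not_critical

open Classical in
/-- The covers of cardinality `i` with the property `P`. -/
noncomputable def covers (t k i : ℕ) (P : Finset (Fin k) → Prop) : Finset (Finset (Fin k)) :=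
  Finset.univ.filter fun S => S.card = i ∧ Cov t S ∧ P S

theorem mem_covers {i : ℕ} {P : Finset (Fin k) → Prop} {S : Finset (Fin k)} :
    S ∈ covers t k i P ↔ S.card = i ∧ Cov t S ∧ P S := by
  simp [covers]

/-- Inserting and erasing the pivot are inverse bijections between the two halves of the matching.
-/
theorem card_lower_eq (t k i : ℕ) :
    (covers t k i (Lower t)).card = (covers t k (i + 1) (Upper t)).card := by
  have hL : ∀ S ∈ covers t k i (Lower t), ∃ q, q ∉ S ∧ IsPivot t S q := fun S hS => by
    simpa [Lower] using (mem_covers.1 hS).2.2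
  have hU : ∀ S ∈ covers t k (i + 1) (Upper t), ∃ q, q ∈ S ∧ IsPivot t S q := fun S hS => by
    simpa [Upper] using (mem_covers.1 hS).2.2
  choose f hf hf' using hL
  choose g hg hg' using hU
  refine Finset.card_bij' (fun S hS => insert (f S hS) S) (fun S hS => S.erase (g S hS)) ?_ ?_ ?_ ?_
  · intro S hS
    obtain ⟨h1, h2, -⟩ := mem_covers.1 hS
    exact mem_covers.2 ⟨by rw [Finset.card_insert_of_notMem (hf S hS), h1],
      h2.mono (Finset.subset_insert _ _), _, Finset.mem_insert_self _ _, (hf' S hS).insert⟩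
  · intro S hS
    obtain ⟨h1, h2, -⟩ := mem_covers.1 hS
    exact mem_covers.2 ⟨by rw [Finset.card_erase_of_mem (hg S hS), h1, Nat.add_sub_cancel],
      h2.erase (hg' S hS), _, Finset.notMem_erase _ _, (hg' S hS).erase⟩
  · intro S hS
    rw [(hg' _ _).unique (hf' S hS).insert, Finset.erase_insert (hf S hS)]
  · intro S hS
    rw [(hf' _ _).unique (hg' S hS).erase, Finset.insert_erase (hg S hS)]

theorem card_covers (t k i : ℕ) : (covers t k i fun _ => True).card =
    (covers t k i (Upper t)).card + (covers t k (i + 1) (Upper t)).card +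
      (covers t k i (Critical t)).card := by
  classical
  rw [← card_lower_eq, ← Finset.card_union_of_disjoint, ← Finset.card_union_of_disjoint]
  · congr 1
    ext S
    simp only [Finset.mem_union, mem_covers]
    have := not_upper_iff (t := t) (S := S)
    tauto
  · rw [Finset.disjoint_left]
    intro S h1 h2
    simp only [Finset.mem_union, mem_covers] at h1 h2
    have := not_upper_iff (t := t) (S := S)
    rcases h1 with h1 | h1
    · tauto
    · exact h1.2.2.not_critical h2.2.2
  · rw [Finset.disjoint_left]
    intro S h1 h2
    simp only [mem_covers] at h1 h2
    have := not_upper_iff (t := t) (S := S)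
    tauto

theorem card_upper_zero (t k : ℕ) : (covers t k 0 (Upper t)).card = 0 := by
  rw [Finset.card_eq_zero, Finset.eq_empty_iff_forall_notMem]
  intro S hS
  obtain ⟨h1, -, q, hq, -⟩ := mem_covers.1 hS
  rw [Finset.card_eq_zero] at h1
  simp [h1] at hq

open Classical in
/-- The pivot of a set that contains its pivot. -/
noncomputable def pivot (t : ℕ) {k : ℕ} (S : Finset (Fin k)) : ℕ :=
  if h : ∃ q, IsPivot t S q then h.choose.1 else 0

theorem IsPivot.pivot_eq {S : Finset (Fin k)} {q : Fin k} (h : IsPivot t S q) :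
    pivot t S = q.1 := by
  have h' : ∃ q, IsPivot t S q := ⟨q, h⟩
  rw [pivot, dif_pos h', h'.choose_spec.unique h]

/-- The rank function that makes the matching acyclic. -/
noncomputable def weight (t : ℕ) {k : ℕ} (S : Finset (Fin k)) : ℕ :=
  (k + 1) * last S + (k - pivot t S)

/-- Acyclicity of the matching: leaving `S` through its partner for another upper set raises the
last element, or keeps it and lowers the pivot. -/
theorem weight_lt {S S' : Finset (Fin k)} {q : Fin k} (hqS : q ∈ S) (hq : IsPivot t S q)
    (hS' : Upper t S') (hsub : S.erase q ⊆ S') (hcard : S'.card = S.card) (hne : S' ≠ S) :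
    weight t S < weight t S' := by
  obtain ⟨q', hqS', hq'⟩ := hS'
  unfold weight
  rw [hq.pivot_eq, hq'.pivot_eq]
  have hle : last S ≤ last S' := by
    rw [← hq.last_erase]
    exact last_mono hsub
  rcases hle.lt_or_eq with h | h
  · have : (k + 1) * (last S + 1) ≤ (k + 1) * last S' := Nat.mul_le_mul_left _ h
    rw [Nat.mul_add] at this
    omega
  -- The last elements agree, so both sets have the same nodes. `S'` still contains the first
  -- non-node of `S`, hence its pivot is not larger; equality would give `S ⊆ S'` and so `S' = S`.
  · rw [← h]
    have hlt : q' < q := by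
      have hne' : q' ≠ q := by
        rintro rfl
        refine hne (Finset.eq_of_subset_of_card_le ?_ hcard.le).symm
        rw [← Finset.insert_erase hqS]
        exact Finset.insert_subset hqS' hsub
      refine lt_of_le_of_ne ?_ hne'
      obtain ⟨s, hs, hq⟩ := hq
      obtain ⟨s', hs', hq'⟩ := hq'
      rw [← h] at hs' hq'
      have hss : s' ≤ s :=
        hs'.2 ⟨hsub (Finset.mem_erase.2 ⟨ne_of_gt hq.1.1, hs.1.1⟩), hs.1.2⟩
      exact hq.2 ⟨hq'.1.1.trans_le hss, hq'.1.2⟩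
    have := Fin.lt_def.1 hlt
    have := q.2
    omega

open Classical in
/-- The set of all nodes up to `e`. -/
noncomputable def nodes (t k e : ℕ) : Finset (Fin k) :=
  Finset.univ.filter fun x => x.1 ≤ e ∧ IsNode t k e x

theorem mem_nodes {e : ℕ} {x : Fin k} : x ∈ nodes t k e ↔ x.1 ≤ e ∧ IsNode t k e x := by
  simp [nodes]

theorem isNode_self {e : ℕ} (he : e < k) : IsNode t k e e ↔ t + 1 ∣ e ∨ t + 1 ∣ k := by
  rw [IsNode, show e + (k - e) = k by omega]

theorem last_nodes {e : ℕ} (he : e < k) (h : IsNode t k e e) : last (nodes t k e) = e := by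
  refine le_antisymm (Finset.sup_le fun i hi => (mem_nodes.1 hi).1) ?_
  exact le_last (i := ⟨e, he⟩) (mem_nodes.2 ⟨le_rfl, h⟩)

theorem critical_nodes {e : ℕ} (he : e < k) (h : IsNode t k e e) : Critical t (nodes t k e) := by
  intro i hi
  rw [last_nodes he h]
  exact (mem_nodes.1 hi).2

theorem cov_nodes {e : ℕ} (he : e < k) (het : k ≤ e + t) (h : IsNode t k e e) :
    Cov t (nodes t k e) := by
  classical
  intro j hj
  by_cases hje : e ≤ j
  · exact ⟨⟨e, he⟩, mem_nodes.2 ⟨le_rfl, h⟩, Or.inl ⟨hje, by simp only; omega⟩⟩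
  · have hex : ∃ x, x ≤ j ∧ IsNode t k e x := ⟨0, by omega, isNode_zero _ _ _⟩
    have hx := Nat.findGreatest_spec (P := IsNode t k e) (Nat.zero_le j) (isNode_zero _ _ _)
    have hxj := Nat.findGreatest_le (P := IsNode t k e) j
    set x := Nat.findGreatest (IsNode t k e) j with hxdef
    obtain ⟨y, hxy, hyt, hy, -, -⟩ := hx.exists_next he het
    have hjy : j < y := by
      by_contra hlt
      have := Nat.le_findGreatest (P := IsNode t k e) (by omega : y ≤ j) hy
      omega
    exact ⟨⟨x, by omega⟩, mem_nodes.2 ⟨by simp only; omega, hx⟩,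
      Or.inl ⟨hxj, by simp only; omega⟩⟩

/-- A cover consisting of nodes cannot skip a node before its last element, by `Cov.mem_of_isNode`;
so it is determined by that element. -/
theorem eq_nodes {S : Finset (Fin k)} (h : Cov t S) (hk : 0 < k) (hc : Critical t S) :
    S = nodes t k (last S) := by
  obtain ⟨i, hi, hie⟩ := last_mem (h.nonempty hk)
  have hn := hc i hi
  rw [hie] at hn
  ext x
  rw [mem_nodes]
  refine ⟨fun hx => ⟨le_last hx, hc x hx⟩, fun ⟨hxe, hx⟩ => ?_⟩
  rcases hxe.lt_or_eq with hlt | heq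
  · obtain ⟨y, hy, hyx⟩ := h.mem_of_isNode le_rfl hx hlt hn (fun i hi _ => hc i hi)
    rwa [← Fin.ext hyx]
  · rwa [← Fin.ext (hie.trans heq.symm)]

theorem card_multiples (n e : ℕ) (hn : 0 < n) :
    ((Finset.range (e + 1)).filter (n ∣ ·)).card = e / n + 1 := by
  have : (Finset.range (e + 1)).filter (n ∣ ·) = (Finset.range (e / n + 1)).image (n * ·) := by
    ext x
    simp only [Finset.mem_filter, Finset.mem_range, Finset.mem_image, Nat.lt_succ_iff]
    constructor
    · rintro ⟨h, c, rfl⟩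
      exact ⟨c, (Nat.le_div_iff_mul_le hn).2 (by rwa [mul_comm]), rfl⟩
    · rintro ⟨c, hc, rfl⟩
      exact ⟨by rw [mul_comm]; exact (Nat.le_div_iff_mul_le hn).1 hc, dvd_mul_right _ _⟩
  rw [this, Finset.card_image_of_injective _ (fun a b h => Nat.eq_of_mul_eq_mul_left hn h), Finset.card_range]

theorem card_multiples_shift (n e g : ℕ) (hn : 0 < n) (hg : 0 < g) (hgn : g < n) :
    ((Finset.range (e + 1)).filter (n ∣ · + g)).card = (e + g) / n := by
  have : (Finset.range (e + 1)).filter (n ∣ · + g) =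
      (Finset.range ((e + g) / n)).image (fun c => n * (c + 1) - g) := by
    ext x
    simp only [Finset.mem_filter, Finset.mem_range, Finset.mem_image]
    constructor
    · rintro ⟨h, c, hc⟩
      have hc0 : c ≠ 0 := by
        rintro rfl
        omega
      obtain ⟨c, rfl⟩ := Nat.exists_eq_succ_of_ne_zero hc0
      refine ⟨c, ?_, by rw [Nat.succ_eq_add_one] at hc; omega⟩
      rw [Nat.lt_iff_add_one_le, Nat.le_div_iff_mul_le hn, mul_comm]
      rw [Nat.succ_eq_add_one] at hc
      omega
    · rintro ⟨c, hc, rfl⟩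
      rw [Nat.lt_iff_add_one_le, Nat.le_div_iff_mul_le hn, mul_comm] at hc
      have : n * 1 ≤ n * (c + 1) := Nat.mul_le_mul_left _ (by omega)
      refine ⟨by omega, ?_⟩
      rw [Nat.sub_add_cancel (by omega)]
      exact dvd_mul_right _ _
  rw [this, Finset.card_image_of_injOn, Finset.card_range]
  intro a _ b _ h
  simp only at h
  have h1 : n * 1 ≤ n * (a + 1) := Nat.mul_le_mul_left _ (by omega)
  have h2 : n * 1 ≤ n * (b + 1) := Nat.mul_le_mul_left _ (by omega)
  have := Nat.eq_of_mul_eq_mul_left hn (show n * (a + 1) = n * (b + 1) by omega)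
  omega

/-- The first two summands count the multiples of `t + 1` up to `e`, the third the `x ≤ e` congruent
to `-(k - e)`. The classes are disjoint because `0 < k - e ≤ t`. -/
theorem card_nodes {e : ℕ} (he : e < k) (het : k ≤ e + t) :
    (nodes t k e).card = e / (t + 1) + 1 + k / (t + 1) := by
  classical
  have h1 : (nodes t k e).map Fin.valEmbedding =
      (Finset.range (e + 1)).filter (t + 1 ∣ ·) ∪
        (Finset.range (e + 1)).filter (t + 1 ∣ · + (k - e)) := by
    ext x
    simp only [Finset.mem_map, mem_nodes, Finset.mem_union, Finset.mem_filter, Finset.mem_range,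
      Fin.valEmbedding_apply, ← and_or_left, Nat.lt_succ_iff]
    constructor
    · rintro ⟨a, ha, rfl⟩
      exact ha
    · intro hx
      exact ⟨⟨x, by omega⟩, hx, rfl⟩
  rw [← Finset.card_map Fin.valEmbedding, h1, Finset.card_union_of_disjoint,
    card_multiples _ _ (by omega), card_multiples_shift _ _ _ (by omega) (by omega) (by omega),
    show e + (k - e) = k by omega]
  rw [Finset.disjoint_left]
  intro x hx hx'
  simp only [Finset.mem_filter] at hx hx'
  have := Nat.le_of_dvd (by omega) ((Nat.dvd_add_right hx.2).1 hx'.2)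
  omega

open Classical in
theorem card_critical (t k i : ℕ) (hk : 0 < k) : (covers t k i (Critical t)).card =
    ((Finset.range k).filter fun e => k ≤ e + t ∧ (t + 1 ∣ e ∨ t + 1 ∣ k) ∧
      e / (t + 1) + 1 + k / (t + 1) = i).card := by
  refine Finset.card_bij' (fun S _ => last S) (fun e _ => nodes t k e) ?_ ?_ ?_ ?_
  · intro S hS
    obtain ⟨h1, h2, h3⟩ := mem_covers.1 hS
    have h4 := h2.last_lt hk
    have h5 := h2.le_last_add hk
    obtain ⟨j, hj, hje⟩ := last_mem (h2.nonempty hk)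
    have h6 := h3 j hj
    rw [hje, isNode_self h4] at h6
    rw [eq_nodes h2 hk h3, card_nodes h4 h5] at h1
    simp only [Finset.mem_filter, Finset.mem_range]
    exact ⟨h4, h5, h6, h1⟩
  · intro e he
    simp only [Finset.mem_filter, Finset.mem_range] at he
    obtain ⟨h1, h2, h3, h4⟩ := he
    rw [← isNode_self h1] at h3
    exact mem_covers.2 ⟨by rw [card_nodes h1 h2, h4], cov_nodes h1 h2 h3, critical_nodes h1 h3⟩
  · intro S hS
    obtain ⟨h1, h2, h3⟩ := mem_covers.1 hS
    exact (eq_nodes h2 hk h3).symm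
  · intro e he
    simp only [Finset.mem_filter, Finset.mem_range] at he
    obtain ⟨h1, h2, h3, h4⟩ := he
    exact last_nodes h1 ((isNode_self h1).2 h3)

/-- If `d = 0`, each of the `t` values `e` in `[k - t, k)` is admissible and has `e / (t + 1) = p -
1`, giving size `2p`. If `d ≠ 0`, the only multiple of `t + 1` in that range is `p(t + 1)`, giving
size `2p + 1`. -/
theorem card_critical_eq {t k p d : ℕ} (i : ℕ) (htk : t ≤ k) (hk : 0 < k)
    (hkp : k = p * (t + 1) + d) (hd : d ≤ t) : (covers t k i (Critical t)).card =
    if d = 0 ∧ i = 2 * p then t else if d ≠ 0 ∧ i = 2 * p + 1 then 1 else 0 := by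
  classical
  rw [card_critical t k i hk]
  have hdiv : k / (t + 1) = p := by
    rw [hkp, mul_comm, Nat.mul_add_div (by omega), Nat.div_eq_of_lt (by omega), add_zero]
  have hdvd : t + 1 ∣ k ↔ d = 0 := by
    rw [hkp, Nat.dvd_add_right (dvd_mul_left _ _)]
    exact ⟨fun h => Nat.eq_zero_of_dvd_of_lt h (by omega), fun h => h ▸ dvd_zero _⟩
  simp only [hdiv, hdvd]
  by_cases hd0 : d = 0
  · have key : ∀ e, e < k → k ≤ e + t → e / (t + 1) + 1 = p := by
      intro e h1 h2
      subst hd0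
      obtain ⟨p, rfl⟩ : ∃ p', p = p' + 1 := Nat.exists_eq_succ_of_ne_zero (by rintro rfl; omega)
      rw [Nat.add_mul] at hkp
      rw [Nat.div_eq_of_lt_le (k := p) (by omega) (by rw [Nat.add_mul]; omega)]
    by_cases hi : i = 2 * p
    · rw [if_pos ⟨hd0, hi⟩]
      have : ((Finset.range k).filter fun e => k ≤ e + t ∧ (t + 1 ∣ e ∨ d = 0) ∧
          e / (t + 1) + 1 + p = i) = Finset.Ico (k - t) k := by
        ext e
        simp only [Finset.mem_filter, Finset.mem_range, Finset.mem_Ico]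
        constructor
        · rintro ⟨h1, h2, -⟩
          omega
        · rintro ⟨h1, h2⟩
          exact ⟨h2, by omega, Or.inr hd0, by rw [key e h2 (by omega)]; omega⟩
      rw [this, Nat.card_Ico]
      omega
    · rw [if_neg (by tauto), if_neg (by tauto), Finset.card_eq_zero,
        Finset.filter_eq_empty_iff]
      rintro e he ⟨h1, -, h2⟩
      rw [key e (Finset.mem_range.1 he) h1] at h2
      omega
  · have key : ∀ e, e < k → k ≤ e + t → t + 1 ∣ e → e = p * (t + 1) := by
      intro e h1 h2 h3
      have h4 : t + 1 ∣ p * (t + 1) := dvd_mul_left _ _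
      rcases lt_trichotomy e (p * (t + 1)) with h | h | h
      · have := add_le_of_dvd h3 h4 h
        omega
      · exact h
      · have := add_le_of_dvd h4 h3 h
        omega
    by_cases hi : i = 2 * p + 1
    · rw [if_neg (by tauto), if_pos ⟨hd0, hi⟩, Finset.card_eq_one]
      refine ⟨p * (t + 1), ?_⟩
      ext e
      simp only [Finset.mem_filter, Finset.mem_range, Finset.mem_singleton]
      constructor
      · rintro ⟨h1, h2, h3, -⟩
        exact key e h1 h2 (by tauto)
      · rintro rfl
        refine ⟨by omega, by omega, Or.inl (dvd_mul_left _ _), ?_⟩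
        rw [Nat.mul_div_cancel _ (by omega)]
        omega
    · rw [if_neg (by tauto), if_neg (by tauto), Finset.card_eq_zero,
        Finset.filter_eq_empty_iff]
      rintro e he ⟨h1, h3, h2⟩
      have := key e (Finset.mem_range.1 he) h1 (by tauto)
      rw [this, Nat.mul_div_cancel _ (by omega)] at h2
      omega

end CyclicCover

/-! ### Rank bounds from an acyclic matching -/

/-- A family of basis vectors on which a matrix is triangular bounds its rank from below. -/
theorem card_le_finrank_range {K X Y : Type*} [Field K] [Fintype X] [Fintype Y]
    (M : Matrix Y X K) (U : Finset X) (τ : ∀ a ∈ U, Y) (f : X → ℕ)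
    (hdiag : ∀ a ha, M (τ a ha) a ≠ 0)
    (hlt : ∀ a ha, ∀ b ∈ U, b ≠ a → M (τ a ha) b ≠ 0 → f a < f b) :
    U.card ≤ Module.finrank K (LinearMap.range M.mulVecLin) := by
  classical
  let E : (U → K) →ₗ[K] (X → K) :=
    LinearMap.pi fun x => if h : x ∈ U then LinearMap.proj ⟨x, h⟩ else 0
  have hE : ∀ v x, (h : x ∈ U) → E v x = v ⟨x, h⟩ := fun v x h => by simp [E, h]
  have hE' : ∀ v x, x ∉ U → E v x = 0 := fun v x h => by simp [E, h]
  have hinj : Function.Injective (M.mulVecLin ∘ₗ E) := by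
    rw [← LinearMap.ker_eq_bot, LinearMap.ker_eq_bot']
    intro v hv
    by_contra hne
    obtain ⟨a₀, ha₀⟩ := Function.ne_iff.1 hne
    -- For `a` with `f a` maximal on the support of `v`, only the diagonal entry contributes to row
    -- `τ a`.
    obtain ⟨a, ha, hmax⟩ := Finset.exists_max_image
      (Finset.univ.filter fun a : U => v a ≠ 0) (fun a => f a) ⟨a₀, by simpa using ha₀⟩
    simp only [Finset.mem_filter, Finset.mem_univ, true_and] at ha hmax
    have h1 := congrFun hv (τ a a.2)
    change ∑ b, M (τ a a.2) b * E v b = 0 at h1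
    rw [Finset.sum_eq_single a.1] at h1
    · rw [hE v a a.2] at h1
      exact mul_ne_zero (hdiag a a.2) ha h1
    · intro b _ hba
      by_cases hb : b ∈ U
      · by_contra h2
        have h3 := hlt a a.2 b hb hba (left_ne_zero_of_mul h2)
        have h4 := hmax ⟨b, hb⟩ (by
          have := right_ne_zero_of_mul h2
          rwa [hE v b hb] at this)
        simp only at h4
        omega
      · rw [hE' v b hb, mul_zero]
    · simp
  calc U.card = Module.finrank K (U → K) := by simp
    _ = Module.finrank K (LinearMap.range (M.mulVecLin ∘ₗ E)) :=
        (LinearMap.finrank_range_of_inj hinj).symm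
    _ ≤ _ := Submodule.finrank_mono (LinearMap.range_comp_le_range _ _)

/-- If the homology bound from a matching is concentrated in one degree, it is attained. -/
theorem rank_eq_of_concentrated {x u c r : ℕ → ℕ} {i₀ : ℕ} (hx : ∀ i, x i = u i + u (i + 1) + c i)
    (hu : u 0 = 0) (hc : ∀ i, i ≠ i₀ → c i = 0) (hr : ∀ i, u (i + 1) ≤ r i) (hr0 : r 0 ≤ x 0)
    (hrr : ∀ i, r i + r (i + 1) ≤ x (i + 1)) (i : ℕ) :
    r i + r (i + 1) + c (i + 1) = x (i + 1) := by
  have h1 := hx (i + 1)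
  have h2 := hrr i
  have h3 := hr i
  have h4 := hr (i + 1)
  by_cases hi : i + 1 = i₀
  -- In the critical degree the upper bound leaves slack, so the two ranks are pinned down from the
  -- neighbouring degrees, where nothing is critical.
  · have h5 := hc (i + 1 + 1) (by omega)
    have h6 := hx (i + 1 + 1)
    have h7 := hrr (i + 1)
    have h8 := hr (i + 1 + 1)
    have h9 : r i = u (i + 1) := by
      cases i with
      | zero =>
        have := hc 0 (by omega)
        have := hx 0
        omega
      | succ i =>
        have := hc (i + 1) (by omega)
        have := hx (i + 1)
        have := hrr i
        have := hr i
        omega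
    omega
  · have := hc (i + 1) hi
    omega

/-! ### Existence of minimal graded free resolutions -/

namespace MinimalGradedFreeResolution

variable {σ K : Type*} [Field K]

theorem mem_span_range_X {p : MvPolynomial σ K} (h : constantCoeff p = 0) :
    p ∈ Ideal.span (Set.range (X : σ → MvPolynomial σ K)) := by
  rw [← Set.image_univ, mem_ideal_span_X_image]
  intro e he
  by_contra hne
  push Not at hne
  obtain rfl : e = 0 := Finsupp.ext fun i => hne i (Set.mem_univ i)
  exact mem_support_iff.1 he h

/-- Every graded submodule has a minimal homogeneous system of generators. -/
theorem exists_minimal_cover [Finite σ] {r : ℕ} (deg : Fin r → ℕ)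
    (N : Submodule (MvPolynomial σ K) (Fin r → MvPolynomial σ K))
    (hN : ∀ v ∈ N, ∀ j, comp deg j v ∈ N) :
    ∃ (r' : ℕ) (deg' : Fin r' → ℕ) (f : (Fin r' → MvPolynomial σ K) →ₗ[MvPolynomial σ K]
      (Fin r → MvPolynomial σ K)), IsGraded deg' deg f ∧ LinearMap.range f = N ∧
        ∀ v, f v = 0 → ∀ a, v a ∈ Ideal.span (Set.range (X : σ → MvPolynomial σ K)) := by
  classical
  let P : ℕ → Prop := fun r' => ∃ (deg' : Fin r' → ℕ) (g : Fin r' → Fin r → MvPolynomial σ K),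
    (∀ a, g a ∈ gradedFreePiece deg (deg' a)) ∧
      Submodule.span (MvPolynomial σ K) (Set.range g) = N
  have hP : ∃ r', P r' := by
    let S : Set (Fin r → MvPolynomial σ K) := {v | v ∈ N ∧ ∃ j, v ∈ gradedFreePiece deg j}
    have hS : Submodule.span (MvPolynomial σ K) S = N := by
      refine le_antisymm (Submodule.span_le.2 fun v hv => hv.1) ?_
      have key : ∀ w : Fin r → MvPolynomial σ K, ∃ s : Finset ℕ, w = ∑ j ∈ s, comp deg j w := by
        intro w
        refine ⟨Finset.univ.biUnion fun a => (w a).support.image fun e => e.degree + deg a, ?_⟩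
        ext a e
        rw [Finset.sum_apply, coeff_sum]
        simp only [coeff_comp, Finset.sum_ite_eq, Finset.mem_biUnion, Finset.mem_univ, true_and,
          Finset.mem_image, mem_support_iff]
        split_ifs with h
        · rfl
        · by_contra hne
          exact h ⟨a, e, hne, rfl⟩
      intro v hv
      obtain ⟨s, hs⟩ := key v
      rw [hs]
      exact Submodule.sum_mem _ fun j _ =>
        Submodule.subset_span ⟨hN v hv j, j, comp_mem deg j v⟩
    have hfg : (Submodule.span (MvPolynomial σ K) S).FG := IsNoetherian.noetherian _
    obtain ⟨T, hTS, hT⟩ := (Submodule.fg_span_iff_fg_span_finset_subset S).1 hfg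
    have hmem : ∀ a : Fin T.card, ∃ j, (T.equivFin.symm a).1 ∈ gradedFreePiece deg j :=
      fun a => (hTS (T.equivFin.symm a).2).2
    choose deg' hdeg' using hmem
    refine ⟨T.card, deg', fun a => (T.equivFin.symm a).1, hdeg', ?_⟩
    have : Set.range (fun a => (T.equivFin.symm a).1) = (T : Set (Fin r → MvPolynomial σ K)) := by
      rw [← Function.comp_def, Set.range_comp, Equiv.range_eq_univ, Set.image_univ]
      exact Subtype.range_coe
    rw [this, ← hT, hS]
  -- Take the smallest possible number of homogeneous generators. A relation with a unit constant
  -- term would make one of them redundant.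
  obtain ⟨deg', g, hg, hspan⟩ := Nat.find_spec hP
  have hmin : ∀ r' < Nat.find hP, ¬ P r' := fun r' h => Nat.find_min hP h
  generalize Nat.find hP = r' at deg' g hg hspan hmin
  obtain ⟨f, hf, hfg⟩ := exists_graded_map deg' deg g hg
  have hfv : ∀ v, f v = ∑ a, v a • g a := by
    intro v
    conv_lhs => rw [eq_sum_basis v]
    simp only [map_sum, map_smul, hfg]
  refine ⟨r', deg', f, hf, ?_, fun v hv a => ?_⟩
  · rw [← hspan, ← Fintype.range_linearCombination]
    congr 1
    exact LinearMap.ext hfv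
  · by_contra hne
    replace hne : constantCoeff (v a) ≠ 0 := fun h => hne (mem_span_range_X h)
    obtain ⟨r'', rfl⟩ : ∃ r'', r' = r'' + 1 :=
      Nat.exists_eq_succ_of_ne_zero (by rintro rfl; exact a.elim0)
    refine hmin r'' (by omega) ⟨deg' ∘ a.succAbove, g ∘ a.succAbove, fun b => hg _, ?_⟩
    refine le_antisymm ?_ ?_
    · rw [← hspan]
      exact Submodule.span_mono (Set.range_comp_subset_range _ _)
    · rw [← hspan, Submodule.span_le]
      rintro _ ⟨b, rfl⟩
      by_cases hb : b = a
      swap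
      · obtain ⟨c, rfl⟩ := Fin.exists_succAbove_eq hb
        exact Submodule.subset_span ⟨c, rfl⟩
      subst hb
      -- In the degree of `g b`, the relation has a nonzero constant as coefficient of `g b`, so it
      -- can be solved for `g b`.
      have h1 : f (comp deg' (deg' b) v) = 0 := by rw [hf.map_comp, hv, map_zero]
      have h2 : comp deg' (deg' b) v b = C (constantCoeff (v b)) := by
        ext e
        rw [coeff_comp, coeff_C]
        by_cases he : e = 0
        · subst he
          simp [constantCoeff_eq]
        · have : e.degree ≠ 0 := fun h => he ((Finsupp.degree_eq_zero_iff e).1 h)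
          rw [if_neg (by omega), if_neg (Ne.symm he)]
      rw [hfv, Fin.sum_univ_succAbove _ b, h2, add_eq_zero_iff_eq_neg] at h1
      have h3 : g b = (C (constantCoeff (v b))⁻¹ : MvPolynomial σ K) •
          (C (constantCoeff (v b)) : MvPolynomial σ K) • g b := by
        rw [smul_smul, ← C_mul, inv_mul_cancel₀ hne, C_1, one_smul]
      rw [SetLike.mem_coe, h3, h1]
      exact Submodule.smul_mem _ _ (Submodule.neg_mem _ (Submodule.sum_mem _ fun c _ =>
        Submodule.smul_mem _ _ (Submodule.subset_span ⟨c, rfl⟩)))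

/-- A graded submodule of a graded free module `F` that is contained in `𝔪 F`. -/
structure SmallSubmodule (σ K : Type*) [Field K] where
  /-- the rank of the free module -/
  rank : ℕ
  /-- the degrees of the basis elements -/
  deg : Fin rank → ℕ
  /-- the submodule -/
  N : Submodule (MvPolynomial σ K) (Fin rank → MvPolynomial σ K)
  comp_mem : ∀ v ∈ N, ∀ j, comp deg j v ∈ N
  small : ∀ v ∈ N, ∀ a, v a ∈ Ideal.span (Set.range (X : σ → MvPolynomial σ K))

theorem SmallSubmodule.exists_next [Finite σ] (s : SmallSubmodule σ K) :
    ∃ (s' : SmallSubmodule σ K) (f : (Fin s'.rank → MvPolynomial σ K) →ₗ[MvPolynomial σ K]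
      (Fin s.rank → MvPolynomial σ K)), IsGraded s'.deg s.deg f ∧ LinearMap.range f = s.N ∧
        LinearMap.ker f = s'.N := by
  obtain ⟨r', deg', f, hf, hr, hk⟩ := exists_minimal_cover s.deg s.N s.comp_mem
  exact ⟨⟨r', deg', LinearMap.ker f, fun v hv j => by
    rw [LinearMap.mem_ker] at *
    rw [hf.map_comp, hv, map_zero], fun v hv => hk v hv⟩, f, hf, hr, rfl⟩

/-- Minimal graded free resolutions exist. -/
theorem nonempty_of_homogeneous [Finite σ] (I : Ideal (MvPolynomial σ K))
    (hI : ∀ f ∈ I, ∀ j, homogeneousComponent j f ∈ I)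
    (hm : I ≤ Ideal.span (Set.range (X : σ → MvPolynomial σ K))) :
    Nonempty (MinimalGradedFreeResolution I) := by
  -- Start with `I` inside `R` and repeatedly replace the submodule by the kernel of a minimal
  -- cover; minimality of the cover keeps each kernel inside `𝔪 F`.
  choose next f hf hr hk using SmallSubmodule.exists_next (σ := σ) (K := K)
  let s₀ : SmallSubmodule σ K :=
    { rank := 1
      deg := fun _ => 0
      N := Submodule.comap (LinearMap.proj 0) I
      comp_mem := by
        intro v hv j
        rw [Submodule.mem_comap, LinearMap.proj_apply] at *
        have : comp (fun _ => 0) j v 0 = homogeneousComponent j (v 0) := by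
          simp [comp]
        rw [this]
        exact hI _ hv j
      small := by
        intro v hv a
        rw [Subsingleton.elim a 0]
        exact hm hv }
  let s : ℕ → SmallSubmodule σ K := fun i => Nat.rec s₀ (fun _ s => next s) i
  refine ⟨{
    rank := fun i => (s i).rank
    deg := fun i => (s i).deg
    d := fun i => f (s i)
    aug := Submodule.mkQ I ∘ₗ LinearMap.proj (0 : Fin 1)
    d_graded := fun i => hf (s i)
    aug_graded := ?_
    aug_surjective := ?_
    exact_zero := ?_
    exact_succ := ?_
    minimal := ?_ }⟩
  · intro j v hv
    refine ⟨v (0 : Fin 1), fun e he => ?_, rfl⟩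
    have h := mem_piece.1 hv (0 : Fin 1) _ he
    rw [← h, Finsupp.degree_eq_weight_one]
    rfl
  · intro y
    obtain ⟨p, rfl⟩ := Submodule.mkQ_surjective _ y
    exact ⟨fun _ => p, rfl⟩
  · intro v
    rw [LinearMap.comp_apply, Submodule.mkQ_apply, Submodule.Quotient.mk_eq_zero,
      ← LinearMap.coe_range, hr (s 0)]
    rfl
  · intro i v
    rw [← LinearMap.coe_range, hr (s (i + 1)), ← LinearMap.mem_ker, hk (s i)]
    rfl
  · intro i v
    exact (s i).small _ (by rw [← hr (s i)]; exact ⟨v, rfl⟩)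

end MinimalGradedFreeResolution

/-! ### Homogeneity of monomial ideals -/

namespace MonomialIdeal

variable {α σ K : Type*} [Field K] (m : α → σ →₀ ℕ)

theorem homogeneousComponent_mem {f : MvPolynomial σ K}
    (hf : f ∈ Ideal.span (Set.range fun x => monomial (m x) (1 : K))) (j : ℕ) :
    homogeneousComponent j f ∈ Ideal.span (Set.range fun x => monomial (m x) (1 : K)) := by
  rw [show (Set.range fun x => monomial (m x) (1 : K)) = (fun s => monomial s 1) '' Set.range m
    from Set.range_comp (fun s => monomial s 1) m] at *
  rw [mem_ideal_span_monomial_image] at *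
  intro e he
  refine hf e ?_
  rw [mem_support_iff, coeff_homogeneousComponent] at *
  exact fun h => he (by simp [h])

theorem span_le_span_X (hm : ∀ x, m x ≠ 0) :
    Ideal.span (Set.range fun x => monomial (m x) (1 : K)) ≤
      Ideal.span (Set.range (X : σ → MvPolynomial σ K)) := by
  classical
  rw [Ideal.span_le]
  rintro _ ⟨x, rfl⟩
  refine MinimalGradedFreeResolution.mem_span_range_X ?_
  rw [constantCoeff_monomial, if_neg (hm x)]

end MonomialIdeal

/-! ### The path ideal of the cycle and its covers -/

namespace CyclePath

/-- The exponent vector of the path that starts after position `i * l`. -/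
noncomputable def expo (m l n i : ℕ) : ZMod n →₀ ℕ :=
  ∑ j ∈ Finset.Icc 1 m, Finsupp.single (((i * l + j : ℕ) : ZMod n)) 1

variable {m l n k s t : ℕ}

theorem expo_apply [NeZero n] (i : ℕ) (v : ZMod n) : expo m l n i v =
    ((Finset.Icc 1 m).filter fun j => ((i * l + j : ℕ) : ZMod n) = v).card := by
  classical
  rw [expo, Finsupp.finsetSum_apply, Finset.card_filter]
  exact Finset.sum_congr rfl fun j _ => Finsupp.single_apply

theorem expo_le_one [NeZero n] (hmn : m ≤ n) (i : ℕ) (v : ZMod n) : expo m l n i v ≤ 1 := by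
  rw [expo_apply, Finset.card_le_one]
  intro a ha b hb
  simp only [Finset.mem_filter, Finset.mem_Icc] at ha hb
  have h := ha.2.trans hb.2.symm
  rw [ZMod.natCast_eq_natCast_iff] at h
  have h' : a ≡ b [MOD n] := Nat.ModEq.add_left_cancel' _ h
  rcases lt_trichotomy a b with hlt | heq | hlt
  · have := Nat.le_of_dvd (by omega) ((Nat.modEq_iff_dvd' hlt.le).1 h')
    omega
  · exact heq
  · have := Nat.le_of_dvd (by omega) ((Nat.modEq_iff_dvd' hlt.le).1 h'.symm)
    omega

theorem expo_ne_zero_iff [NeZero n] (i : ℕ) (v : ZMod n) : expo m l n i v ≠ 0 ↔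
    ∃ j ∈ Finset.Icc 1 m, ((i * l + j : ℕ) : ZMod n) = v := by
  rw [expo_apply, Finset.card_ne_zero, Finset.filter_nonempty_iff]

theorem expo_ne_zero [NeZero n] (hm : 1 ≤ m) (i : ℕ) : expo m l n i ≠ 0 := by
  intro h
  refine (expo_ne_zero_iff (m := m) (l := l) i ((i * l + 1 : ℕ) : ZMod n)).2
    ⟨1, by simp [hm], rfl⟩ ?_
  rw [h]
  rfl

theorem cyclePathIdeal_eq (K : Type*) [Field K] (hln : l ∣ n) (hk : k = n / l) :
    cyclePathIdeal K m l n =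
      Ideal.span (Set.range fun i : Fin k => monomial (expo m l n i) (1 : K)) := by
  have hmon : ∀ i : ℕ, monomial (expo m l n i) (1 : K) =
      ∏ j ∈ Finset.Icc 1 m, X (((i * l + j : ℕ) : ZMod n)) := by
    intro i
    rw [expo, monomial_sum_one]
    rfl
  unfold cyclePathIdeal
  rw [Nat.gcd_eq_left hln, ← hk]
  congr 1
  ext u
  constructor
  · rintro ⟨i, hi, rfl⟩
    rw [Finset.mem_Icc] at hi
    exact ⟨⟨i - 1, by omega⟩, hmon _⟩
  · rintro ⟨i, rfl⟩
    refine ⟨i + 1, Finset.mem_Icc.2 ⟨by omega, i.2⟩, ?_⟩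
    simp only
    rw [hmon, Nat.add_sub_cancel]

theorem sup_apply_ne_zero_iff {α σ : Type*} (S : Finset α) (f : α → σ →₀ ℕ) (v : σ) :
    S.sup f v ≠ 0 ↔ ∃ i ∈ S, f i v ≠ 0 := by
  classical
  induction S using Finset.induction_on with
  | empty => simp [bot_eq_zero]
  | insert a S ha ih =>
    rw [Finset.sup_insert, Finsupp.sup_apply, Finset.exists_mem_insert, ← ih]
    omega

/-- As `m ≤ n`, the generators are squarefree, so the lcm has degree `n` only if every one of the
`n` variables occurs in it. -/
theorem degree_sup_eq_iff [NeZero n] (hmn : m ≤ n) (S : Finset (Fin k)) :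
    (S.sup fun i => expo m l n i).degree = n ↔
      ∀ v : ZMod n, ∃ i ∈ S, ∃ j ∈ Finset.Icc 1 m, ((i.1 * l + j : ℕ) : ZMod n) = v := by
  have h1 : ∀ v : ZMod n, (S.sup fun i => expo m l n i) v ≤ 1 := by
    have : (S.sup fun i => expo m l n i) ≤ Finsupp.equivFunOnFinite.symm fun _ => 1 :=
      Finset.sup_le fun i _ v => expo_le_one hmn i v
    exact this
  have h2 : (S.sup fun i => expo m l n i).degree = ∑ v, (S.sup fun i => expo m l n i) v :=
    Finsupp.degree_eq_sum _
  have h3 : n = ∑ _v : ZMod n, 1 := by simp [ZMod.card]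
  have h4 := Finset.sum_eq_sum_iff_of_le (s := Finset.univ) fun v (_ : v ∈ Finset.univ) => h1 v
  rw [← h3, ← h2] at h4
  rw [h4]
  refine ⟨fun h v => ?_, fun h v _ => ?_⟩
  · have h5 : (S.sup fun i : Fin k => expo m l n i) v ≠ 0 := by
      rw [h v (Finset.mem_univ v)]
      exact one_ne_zero
    obtain ⟨i, hi, h6⟩ := (sup_apply_ne_zero_iff _ _ _).1 h5
    exact ⟨i, hi, (expo_ne_zero_iff _ _).1 h6⟩
  · obtain ⟨i, hi, h6⟩ := h v
    have := (sup_apply_ne_zero_iff S (fun i : Fin k => expo m l n i) v).2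
      ⟨i, hi, (expo_ne_zero_iff _ _).2 h6⟩
    have := h1 v
    omega

/-- The path from block `i` fills blocks `i, …, i + t - 1` and meets block `i + t` only in its first
`s < l` vertices. So covering all blocks is sufficient, and testing the last vertex of each block
shows that it is necessary. -/
theorem cov_iff [NeZero n] (hl : 1 ≤ l) (hn : n = k * l) (hs : s < l) (hmt : m = t * l + s)
    (htk : t ≤ k) (S : Finset (Fin k)) : CyclicCover.Cov t S ↔
      ∀ v : ZMod n, ∃ i ∈ S, ∃ j ∈ Finset.Icc 1 m, ((i.1 * l + j : ℕ) : ZMod n) = v := by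
  constructor
  · intro h v
    -- Vertices are numbered from `1`; after this shift the block of `v` is `a / l`.
    set a := (v - 1).val with ha
    have hv : ((a + 1 : ℕ) : ZMod n) = v := by
      rw [Nat.cast_add, ha, ZMod.natCast_zmod_val]
      simp
    have han : a < l * k := by
      rw [mul_comm, ← hn]
      exact ZMod.val_lt _
    have hdiv := Nat.div_add_mod a l
    have hmod := Nat.mod_lt a hl
    have hb := Nat.div_lt_of_lt_mul han
    generalize a / l = b at hdiv hb
    generalize a % l = r at hdiv hmod
    obtain ⟨i, hi, h⟩ := h b hb
    rcases h with ⟨h1, h2⟩ | h1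
    · obtain ⟨c, hc⟩ := Nat.exists_eq_add_of_le h1
      have h3 : (c + 1) * l ≤ t * l := Nat.mul_le_mul_right _ (by omega)
      rw [hc] at hdiv
      have h4 : l * (i.1 + c) = i.1 * l + c * l := by ring
      rw [Nat.add_mul] at h3
      refine ⟨i, hi, c * l + r + 1, Finset.mem_Icc.2 ⟨by omega, by omega⟩, ?_⟩
      rw [← hv]
      congr 1
      omega
    -- The path wraps around: block `b` is reached as block `b + k`, hence the additional `n` below.
    · have hik := i.2
      obtain ⟨c, hc⟩ := Nat.exists_eq_add_of_le (show i.1 ≤ b + k by omega)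
      have h3 : (c + 1) * l ≤ t * l := Nat.mul_le_mul_right _ (by omega)
      have h4 : l * b + k * l = i.1 * l + c * l := by
        rw [← Nat.add_mul, ← hc]
        ring
      rw [Nat.add_mul] at h3
      refine ⟨i, hi, c * l + r + 1, Finset.mem_Icc.2 ⟨by omega, by omega⟩, ?_⟩
      rw [← hv, show i.1 * l + (c * l + r + 1) = a + 1 + n by omega, Nat.cast_add,
        ZMod.natCast_self, add_zero]
  · intro h j₀ hj₀
    -- The test vertex is the last one of block `j₀`. It forces `l ∣ j`, and `j ≤ t * l + s` with `s
    -- < l` then leaves only the `t` full blocks of the path.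
    obtain ⟨i, hi, j, hj, h⟩ := h ((j₀ * l + l : ℕ) : ZMod n)
    rw [Finset.mem_Icc] at hj
    rw [ZMod.natCast_eq_natCast_iff, hn] at h
    have hlj : l ∣ j := by
      have h1 : i.1 * l + j ≡ j₀ * l + l [MOD l] := h.of_mul_left k
      have h2 : l ∣ i.1 * l + j :=
        (h1.dvd_iff dvd_rfl).2 (dvd_add (dvd_mul_left _ _) dvd_rfl)
      exact (Nat.dvd_add_right (dvd_mul_left _ _)).1 h2
    obtain ⟨c, rfl⟩ := hlj
    have hc0 : c ≠ 0 := by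
      rintro rfl
      omega
    have hct : c < t + 1 := by
      by_contra hlt
      have : l * (t + 1) ≤ l * c := Nat.mul_le_mul_left _ (by omega)
      have h5 : l * (t + 1) = t * l + l := by ring
      omega
    obtain ⟨c, rfl⟩ : ∃ c', c = c' + 1 := Nat.exists_eq_succ_of_ne_zero hc0
    have h1 : (i.1 + c + 1) * l ≡ (j₀ + 1) * l [MOD k * l] := by
      convert h using 1 <;> ring
    have h2 : i.1 + c ≡ j₀ [MOD k] :=
      Nat.ModEq.add_right_cancel' 1 (Nat.ModEq.mul_right_cancel' (by omega) h1)
    refine ⟨i, hi, ?_⟩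
    have hik := i.2
    rcases lt_or_ge (i.1 + c) k with hlt | hge
    · have := Nat.ModEq.eq_of_lt_of_lt h2 hlt hj₀
      omega
    · have h3 : i.1 + c - k ≡ j₀ [MOD k] := by
        refine Nat.ModEq.trans ?_ h2
        conv_rhs => rw [← Nat.sub_add_cancel hge]
        exact (Nat.add_modEq_right).symm
      have := Nat.ModEq.eq_of_lt_of_lt h3 (by omega) hj₀
      omega

end CyclePath

/-! ### From the matching to the Betti numbers -/

section Betti

open CyclicCover

variable {σ K : Type*} [Field K] {k n t : ℕ} {m : Fin k → σ →₀ ℕ}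

theorem card_strand_filter (hcov : ∀ S : Finset (Fin k), (S.sup m).degree = n ↔ Cov t S) (i : ℕ)
    (P : Finset (Fin k) → Prop) [DecidablePred P] :
    (Finset.univ.filter fun a : {a : {S : Finset (Fin k) // S.card = i} //
      (a.1.sup m).degree = n} => P a.1.1).card = (covers t k i P).card := by
  refine Finset.card_bij (fun a _ => a.1.1) ?_ ?_ ?_
  · intro a ha
    exact mem_covers.2 ⟨a.1.2, (hcov _).1 a.2, by simpa using ha⟩
  · intro a _ b _ h
    exact Subtype.ext (Subtype.ext h)
  · intro S hS
    obtain ⟨h1, h2, h3⟩ := mem_covers.1 hS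
    exact ⟨⟨⟨S, h1⟩, (hcov _).2 h2⟩, by simpa using h3, rfl⟩

/-- The Taylor complex in degree `n` has at least the ranks that the matching predicts. -/
theorem card_upper_le_finrank (hcov : ∀ S : Finset (Fin k), (S.sup m).degree = n ↔ Cov t S)
    (i : ℕ) : (covers t k (i + 1) (Upper t)).card ≤
      Module.finrank K (LinearMap.range ((Taylor.resolution (K := K) m).redD n i)) := by
  classical
  rw [← card_strand_filter hcov]
  have hτ : ∀ a ∈ Finset.univ.filter fun a : {a : {S : Finset (Fin k) // S.card = i + 1} //
      (a.1.sup m).degree = n} => Upper t a.1.1, ∃ q ∈ a.1.1, IsPivot t a.1.1 q := by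
    intro a ha
    exact (Finset.mem_filter.1 ha).2
  choose q hq hq' using hτ
  refine card_le_finrank_range _ _
    (fun a ha => ⟨⟨a.1.1.erase (q a ha), by
      rw [Finset.card_erase_of_mem (hq a ha), a.1.2, Nat.add_sub_cancel]⟩,
      (hcov _).2 (((hcov _).1 a.2).erase (hq' a ha))⟩)
    (fun a => weight t a.1.1) ?_ ?_
  · intro a ha
    refine Taylor.constantCoeff_d_single_ne_zero m a.1 _ (Finset.erase_subset _ _) ?_
    exact ((hcov _).2 (((hcov _).1 a.2).erase (hq' a ha))).trans a.2.symm
  · intro a ha b hb hba hM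
    refine weight_lt (hq a ha) (hq' a ha) (Finset.mem_filter.1 hb).2 ?_ (by rw [b.1.2, a.1.2])
      (fun h => hba (Subtype.ext (Subtype.ext h)))
    by_contra hsub
    refine hM ?_
    have := Taylor.d_single_eq_zero (K := K) m b.1 ⟨a.1.1.erase (q a ha), by
      rw [Finset.card_erase_of_mem (hq a ha), a.1.2, Nat.add_sub_cancel]⟩ hsub
    exact (congrArg constantCoeff this).trans (map_zero _)

/-- The Betti number is the number of covers minus the two adjacent ranks. Since the critical covers
all have size `i₀`, the matching determines these ranks exactly. In homological degree `0` the only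
set is `∅`, whose lcm has degree `0 ≠ n`. -/
theorem betti_eq_card_critical (hn : n ≠ 0)
    (hcov : ∀ S : Finset (Fin k), (S.sup m).degree = n ↔ Cov t S)
    {i₀ : ℕ} (hc : ∀ i, i ≠ i₀ → (covers t k i (Critical t)).card = 0)
    (F : MinimalGradedFreeResolution
      (Ideal.span (Set.range fun x => monomial (m x) (1 : K)))) (i : ℕ) :
    F.betti i n = (covers t k i (Critical t)).card := by
  classical
  set G := Taylor.resolution (K := K) m with hG
  have hI := fun f (hf : f ∈ Ideal.span (Set.range fun x => monomial (m x) (1 : K))) =>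
    MonomialIdeal.homogeneousComponent_mem m hf
  have hx : ∀ i, Module.finrank K ({a // G.deg i a = n} → K) =
      (covers t k i fun _ => True).card := by
    intro i
    rw [Module.finrank_fintype_fun_eq_card, ← card_strand_filter hcov, Finset.filter_true]
    rfl
  cases i with
  | zero =>
    have hempty : (covers t k 0 fun _ => True).card = 0 := by
      rw [Finset.card_eq_zero, Finset.eq_empty_iff_forall_notMem]
      intro S hS
      obtain ⟨h1, h2, -⟩ := mem_covers.1 hS
      rw [Finset.card_eq_zero] at h1
      subst h1
      rw [← hcov, Finset.sup_empty, bot_eq_zero, map_zero] at h2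
      exact hn h2.symm
    have h0 := card_covers t k 0
    rw [F.betti_zero_eq_zero G hI n]
    · omega
    · rintro ⟨S, hS⟩ h
      have : S ∈ covers t k 0 fun _ => True := mem_covers.2 ⟨hS, (hcov S).1 h, trivial⟩
      rw [Finset.card_eq_zero.1 hempty] at this
      simp at this
  | succ i =>
    have hrk : ∀ i, Module.finrank K (LinearMap.range (G.redD n i)) +
        Module.finrank K (LinearMap.ker (G.redD n i)) =
          (covers t k (i + 1) fun _ => True).card := fun i => by
      rw [LinearMap.finrank_range_add_finrank_ker, hx]
    have hb := F.betti_succ_add G hI n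
    have := rank_eq_of_concentrated (x := fun i => (covers t k i fun _ => True).card)
      (u := fun i => (covers t k i (Upper t)).card)
      (c := fun i => (covers t k i (Critical t)).card)
      (r := fun i => Module.finrank K (LinearMap.range (G.redD n i)))
      (card_covers t k) (card_upper_zero t k) hc (card_upper_le_finrank hcov)
      (by rw [← hx]; exact Submodule.finrank_le _)
      (fun i => by
        have := hrk i
        have := hb i
        omega) i
    have := hrk i
    have := hb i
    omega

end Betti

theorem theorem5p1 {K : Type*} [Field K] (l m n k s t p d : ℕ)
    (hl : 1 ≤ l) (hm : 2 ≤ m) (hmn : m ≤ n) (hln : l ∣ n) (hlm : l ≤ m - 1) (hl2 : 2 * l ≤ n)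
    (hs : s < l) (hmt : m = t * l + s) (ht : 2 ≤ t) (hk : k = n / l)
    (hkp : k = p * (t + 1) + d) (hd : d ≤ t) :
    Nonempty (MinimalGradedFreeResolution (cyclePathIdeal K m l n)) ∧
    ∀ (F : MinimalGradedFreeResolution (cyclePathIdeal K m l n)) (i : ℕ),
      F.betti i n =
        if d = 0 ∧ i = 2 * p then t
        else if d ≠ 0 ∧ i = 2 * p + 1 then 1
        else 0 := by
  have hn : n = k * l := by rw [hk, Nat.div_mul_cancel hln]
  have hn0 : n ≠ 0 := by omega
  have : NeZero n := ⟨hn0⟩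
  have hk0 : 0 < k := Nat.pos_of_ne_zero (by rintro rfl; omega)
  -- Cancel `l` in `t * l ≤ m ≤ n = k * l`.
  have htk : t ≤ k := Nat.le_of_mul_le_mul_right (show t * l ≤ k * l by omega) hl
  have hcard := fun i => CyclicCover.card_critical_eq i htk hk0 hkp hd
  rw [CyclePath.cyclePathIdeal_eq K hln hk]
  refine ⟨MinimalGradedFreeResolution.nonempty_of_homogeneous _
    (fun f hf => MonomialIdeal.homogeneousComponent_mem _ hf)
    (MonomialIdeal.span_le_span_X _ fun i => CyclePath.expo_ne_zero (by omega) i), fun F i => ?_⟩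
  rw [← hcard]
  refine betti_eq_card_critical (i₀ := if d = 0 then 2 * p else 2 * p + 1) hn0 (fun S => ?_)
    (fun i hi => ?_) F i
  · rw [CyclePath.cov_iff hl hn hs hmt htk]
    exact CyclePath.degree_sup_eq_iff hmn S
  · rw [hcard]
    by_cases hd0 : d = 0
    · rw [if_pos hd0] at hi
      rw [if_neg (by tauto), if_neg (by tauto)]
    · rw [if_neg hd0] at hi
      rw [if_neg (by tauto), if_neg (by tauto)]
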